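/- Let $k$ be a natural number and let $\mathcal F$ be a collection of predicates $f:\{0,1\}^k\to\{0,1\}$. An instance $\Phi$ of Max-CSP-$\mathcal F$ consists of $n$ Boolean variables and a finite collection of clauses, each of which is a predicate from $\mathcal F$ applied to a tuple of $k$ distinct variables; $\Phi$ is simple if all its clauses are distinct. The value $val(\Phi)$ is the maximum over all assignments of the fraction of clauses that are satisfied ($val(\Phi)=1$ if $\Phi$ has no clauses). For $s<c$, Gap-CSP-$\mathcal F(c,s)$ is the promise problem whose YES-instances are the $\Phi$ with $val(\Phi)\ge c$ and whose NO-instances are the $\Phi$ with $val(\Phi)\le s$. For $p:\mathbb N\to[0,1]$, the clause percolation $\Phi^c_p$ is the random instance on the same variables obtained from $\Phi$ by keeping each clause independently with probability $p(n)$, where $n$ is the number of variables of $\Phi$. Let $0<s<c\le 1$ and let $\varepsilon,\delta>0$ be constants with $s+\varepsilon<c-\varepsilon$. If Gap-CSP-$\mathcal F(c,s)$ is NP-hard, then Gap-CSP-$\mathcal F(c-\varepsilon,s+\varepsilon)$ is NP-hard under a reduction that is robust with respect to clause percolation with any parameter $p>1/n^{k-1-\delta}$. That is, there are an NP-hard promise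 problem $A=(A_{YES},A_{NO})$ and a polynomial-time reduction $r$ from $A$ to $B=(B_{YES},B_{NO})=$ Gap-CSP-$\mathcal F(c-\varepsilon,s+\varepsilon)$ (so $r(A_{YES})\subseteq B_{YES}$ and $r(A_{NO})\subseteq B_{NO}$) such that, for every $p:\mathbb N\to[0,1]$ with $p(n)>1/n^{k-1-\delta}$ for all sufficiently large $n$, $$\Pr[\,r(x)^c_p\in B_{YES}\,]>1-o(1)\ \text{ for all } x\in A_{YES},\qquad \Pr[\,r(x)^c_p\in B_{NO}\,]>1-o(1)\ \text{ for all } x\in A_{NO},$$ where $o(1)$ denotes a function of the input length $|x|$ that tends to $0$ as $|x|\to\infty$. The same implication holds when all instances, in the hypothesis and in the conclusion, are required to be simple. -/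

import Mathlib

open Filter Topology Turing Computability

namespace PercCSP

/-! ### Promise problems, NP-hardness and percolation-robust reductions -/

/-- A promise problem on instances of type `α`: two disjoint sets of instances. -/
structure PromiseProblem (α : Type) where
  yes : Set α
  no : Set α
  disjoint : Disjoint yes no

/-- The promise problem `A` with the additional promise that the instance lies in `S`. -/
def PromiseProblem.restrict {α : Type} (A : PromiseProblem α) (S : Set α) : PromiseProblem α where
  yes := A.yes ∩ S
  no := A.no ∩ S
  disjoint := A.disjoint.mono Set.inter_subset_left Set.inter_subset_left

/-- `f : α → β` is computable in polynomial time by a multi-stack Turing machine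
(time being measured in the length of the encoded input). -/
def PolyTime {α β αΓ βΓ : Type} (ea : Encoding α αΓ) (eb : Encoding β βΓ) (f : α → β) : Prop :=
  Nonempty (TM2ComputableInPolyTime ea.encode eb.encode f)

/-- The class NP of languages of binary strings: there are a polynomial `q` and a polynomial-time
verifier `V` such that `x ∈ L` iff some witness `w` of length at most `q(|x|)` makes `V` accept. -/
def InNP (L : Set (List Bool)) : Prop :=
  ∃ (q : Polynomial ℕ) (V : List Bool × List Bool → Bool),
    PolyTime (encodingProd (encodingList Bool) (encodingList Bool)) encodingBoolBool V ∧
    ∀ x, x ∈ L ↔ ∃ w : List Bool, w.length ≤ q.eval x.length ∧ V (x, w) = true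

/-- A promise problem is NP-hard if every language in NP has a polynomial-time many-one
reduction to it. -/
def NPHard {α αΓ : Type} (ea : Encoding α αΓ) (A : PromiseProblem α) : Prop :=
  ∀ L : Set (List Bool), InNP L →
    ∃ f : List Bool → α, PolyTime (encodingList Bool) ea f ∧
      (∀ x, x ∈ L → f x ∈ A.yes) ∧ (∀ x, x ∉ L → f x ∈ A.no)

/-- `r` is a polynomial-time reduction from the promise problem `A` to the promise problem `B`. -/
structure IsReduction {α αΓ β βΓ : Type} (ea : Encoding α αΓ) (eb : Encoding β βΓ)
    (A : PromiseProblem α) (B : PromiseProblem β) (r : α → β) : Prop where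
  polyTime : PolyTime ea eb r
  map_yes : ∀ x ∈ A.yes, r x ∈ B.yes
  map_no : ∀ x ∈ A.no, r x ∈ B.no

/-- `r` is a `Perc`-robust reduction from `A` to `B`: it is a polynomial-time reduction and
`Pr[Perc (r x) ∈ B.yes] > 1 - o(1)` for `x ∈ A.yes`, and
`Pr[Perc (r x) ∈ B.no] > 1 - o(1)` for `x ∈ A.no`,
where the `o(1)` term is a function of the input length `|x|`, tending to `0` as `|x| → ∞`. -/
structure IsPercRobust {α αΓ β βΓ : Type} (ea : Encoding α αΓ) (eb : Encoding β βΓ)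
    (A : PromiseProblem α) (B : PromiseProblem β) (Perc : β → PMF β) (r : α → β) : Prop
    extends IsReduction ea eb A B r where
  robust : ∃ err : ℕ → ℝ, Tendsto err atTop (𝓝 0) ∧
    (∀ x ∈ A.yes,
      1 - err (ea.encode x).length < ((Perc (r x)).toOuterMeasure B.yes).toReal) ∧
    (∀ x ∈ A.no,
      1 - err (ea.encode x).length < ((Perc (r x)).toOuterMeasure B.no).toReal)

/-- `B` is NP-hard under a reduction that is robust with respect to every percolation in the
family `Percs`: one and the same polynomial-time reduction, from an NP-hard problem `A` to `B`, is
`Perc`-robust for all `Perc ∈ Percs`. -/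
def NPHardUnderRobust {β βΓ : Type} (eb : Encoding β βΓ) (B : PromiseProblem β)
    (Percs : Set (β → PMF β)) : Prop :=
  ∃ (α αΓ : Type) (_ : Fintype αΓ) (ea : Encoding α αΓ) (A : PromiseProblem α) (r : α → β),
    NPHard ea A ∧ IsReduction ea eb A B r ∧ ∀ Perc ∈ Percs, IsPercRobust ea eb A B Perc r

/-! ### Boolean constraint satisfaction problems -/

/-- `k`-ary Boolean predicates. -/
abbrev BoolPred (k : ℕ) : Type := (Fin k → Bool) → Bool

/-- A clause over the variables `x_0, …, x_{n-1}`: a `k`-ary predicate applied to a tuple of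
`k` (distinct) variables. -/
@[ext]
structure Clause (k n : ℕ) where
  pred : BoolPred k
  vars : Fin k ↪ Fin n

/-- The clause is satisfied by the assignment `σ`. -/
def Clause.IsSat {k n : ℕ} (C : Clause k n) (σ : Fin n → Bool) : Bool :=
  C.pred fun l => σ (C.vars l)

/-- An instance of Boolean `k`-CSP: a number of variables and a collection of clauses
(in which a clause may occur several times). -/
structure CSP (k : ℕ) where
  numVars : ℕ
  clauses : List (Clause k numVars)

namespace CSP

variable {k : ℕ}

/-- The instance is simple: all its clauses are distinct. -/
def IsSimple (Φ : CSP k) : Prop := Φ.clauses.Nodup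

/-- All constraints of the instance belong to the family `F`. -/
def IsOver (F : Set (BoolPred k)) (Φ : CSP k) : Prop := ∀ C ∈ Φ.clauses, C.pred ∈ F

/-- The fraction of clauses satisfied by `σ`; the formula without clauses is satisfied by every
assignment, so has value `1`. -/
noncomputable def valAt (Φ : CSP k) (σ : Fin Φ.numVars → Bool) : ℝ :=
  if Φ.clauses.isEmpty then 1
  else (Φ.clauses.countP fun C => C.IsSat σ : ℝ) / (Φ.clauses.length : ℝ)

/-- The value of the instance: the maximum over all assignments. -/
noncomputable def val (Φ : CSP k) : ℝ :=
  Finset.univ.sup' Finset.univ_nonempty Φ.valAt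

end CSP

/-- The promise problem Gap-CSP-`F`(c, s). -/
def gapCSP {k : ℕ} (F : Set (BoolPred k)) (c s : ℝ) (h : s < c) : PromiseProblem (CSP k) where
  yes := {Φ | Φ.IsOver F ∧ c ≤ Φ.val}
  no := {Φ | Φ.IsOver F ∧ Φ.val ≤ s}
  disjoint := Set.disjoint_left.2 fun _ h₁ h₂ => absurd (h₁.2.trans h₂.2) (not_le.2 h)

/-! ### Encoding of instances as strings over a finite alphabet -/

/-- The alphabet: a unary digit `inl true`, an end marker `inl false`, and one symbol for each
`k`-ary Boolean predicate. -/
abbrev Symbol (k : ℕ) : Type := Bool ⊕ BoolPred k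

/-- `i` written in unary, with an end marker. -/
def encUnary (k i : ℕ) : List (Symbol k) := List.replicate i (Sum.inl true) ++ [Sum.inl false]

/-- A clause: its predicate followed by the indices of its variables. -/
def encClause {k n : ℕ} (C : Clause k n) : List (Symbol k) :=
  Sum.inr C.pred :: (List.ofFn fun l => (C.vars l : ℕ)).flatMap (encUnary k)

/-- An instance: the number of variables (in unary) followed by the clauses. -/
def encCSP {k : ℕ} (Φ : CSP k) : List (Symbol k) :=
  encUnary k Φ.numVars ++ Φ.clauses.flatMap encClause

theorem encUnary_append_inj {k : ℕ} : ∀ {a b : ℕ} {u v : List (Symbol k)},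
    encUnary k a ++ u = encUnary k b ++ v → a = b ∧ u = v
  | 0, 0, _, _, h => by simpa [encUnary] using h
  | 0, b + 1, _, _, h => by simp [encUnary, List.replicate_succ] at h
  | a + 1, 0, _, _, h => by simp [encUnary, List.replicate_succ] at h
  | a + 1, b + 1, u, v, h => by
    have h' : encUnary k a ++ u = encUnary k b ++ v := by
      simpa [encUnary, List.replicate_succ] using h
    obtain ⟨rfl, rfl⟩ := encUnary_append_inj h'
    exact ⟨rfl, rfl⟩

theorem flatMap_encUnary_append_inj {k : ℕ} : ∀ {l m : List ℕ} {u v : List (Symbol k)},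
    l.length = m.length → l.flatMap (encUnary k) ++ u = m.flatMap (encUnary k) ++ v →
    l = m ∧ u = v
  | [], [], _, _, _, h => ⟨rfl, by simpa using h⟩
  | [], _ :: _, _, _, hl, _ => by simp at hl
  | _ :: _, [], _, _, hl, _ => by simp at hl
  | a :: l, b :: m, u, v, hl, h => by
    simp only [List.flatMap_cons, List.append_assoc] at h
    obtain ⟨rfl, h'⟩ := encUnary_append_inj h
    obtain ⟨rfl, rfl⟩ := flatMap_encUnary_append_inj (by simpa using hl) h'
    exact ⟨rfl, rfl⟩

theorem flatMap_encClause_inj {k n : ℕ} : ∀ {l m : List (Clause k n)},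
    l.flatMap encClause = m.flatMap encClause → l = m
  | [], [], _ => rfl
  | [], _ :: _, h => by simp [encClause] at h
  | _ :: _, [], h => by simp [encClause] at h
  | C :: l, D :: m, h => by
    simp only [List.flatMap_cons, encClause, List.cons_append, List.cons.injEq,
      Sum.inr.injEq] at h
    obtain ⟨hp, h⟩ := h
    obtain ⟨hv, h'⟩ := flatMap_encUnary_append_inj (by simp) h
    have hCD : C = D := by
      ext1
      · exact hp
      · ext l
        exact congrFun (List.ofFn_injective hv) l
    rw [hCD, flatMap_encClause_inj h']

theorem encCSP_injective {k : ℕ} : Function.Injective (encCSP (k := k)) := by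
  rintro ⟨n, l⟩ ⟨n', l'⟩ h
  obtain ⟨hn, h'⟩ := encUnary_append_inj h
  obtain rfl : n = n' := hn
  obtain rfl : l = l' := flatMap_encClause_inj h'
  rfl

/-- The encoding of instances of Boolean `k`-CSP as strings. -/
noncomputable def cspEncoding (k : ℕ) : Encoding (CSP k) (Symbol k) where
  encode := encCSP
  decode := Function.partialInv encCSP
  decode_encode := Function.partialInv_left encCSP_injective

/-! ### Clause percolation -/

/-- A coin showing `true` with probability `p`. -/
noncomputable def coin (p : unitInterval) : PMF Bool :=
  PMF.ofFintype (fun b => ENNReal.ofReal (if b then (p : ℝ) else 1 - p)) (by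
    rw [Fintype.sum_bool, if_pos rfl, if_neg Bool.false_ne_true,
      ← ENNReal.ofReal_add p.2.1 (sub_nonneg.2 p.2.2)]
    simp)

/-- Keep each entry of a list independently with probability `p`. -/
noncomputable def keepEach {γ : Type} (p : unitInterval) : List γ → PMF (List γ)
  | [] => PMF.pure []
  | C :: L => (coin p).bind fun b => (keepEach p L).map fun L' => if b then C :: L' else L'

/-- Clause percolation: each clause of `Φ` is kept independently with probability `p n`, where
`n` is the number of variables of `Φ`; the set of variables is unchanged. -/
noncomputable def clausePerc {k : ℕ} (p : ℕ → unitInterval) (Φ : CSP k) : PMF (CSP k) :=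
  (keepEach (p Φ.numVars) Φ.clauses).map fun L => ⟨Φ.numVars, L⟩

end PercCSP

/-! The reduction makes an instance dense without changing its value: every variable is replaced by
`N` copies and every clause by all `N ^ k` clauses on copies of its variables. The value is
preserved (`val_blow`). An assignment lifts to the blow-up by being constant on copies. Conversely,
given an assignment of the blow-up, choose one copy of each variable uniformly at random. The
variables of a clause are distinct, so their copies form a uniform tuple, and the induced assignment
satisfies on average the same fraction of clauses (`sum_countP_selectCopies`).

With `n` variables and `m` clauses, the blow-up has `n * N` variables and `m * N ^ k` clauses. Above
the threshold the expected number of surviving clauses exceeds `n * N * (n ^ (δ - k) * N ^ δ)`.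
Taking `N = ℓ ^ d`, with `ℓ` the length of the encoding and `δ * d ≥ k + 1`, makes this at least `n
* N * ℓ` (`mul_le_of_threshold_lt`). A Chernoff bound (`toOuterMeasure_keepEach_sum_nonneg_le`) is
applied to the weights "satisfied minus target value", so the random number of survivors needs no
separate estimate. For long encodings the union bound over `2 ^ (n * N)` assignments then costs less
than the exponent gains (`two_pow_mul_exp_le`). The exponent `d` depends only on `k` and `δ`, so one
reduction serves all `p`. The source problem is the gap problem assumed to be NP-hard.

Much of the work is polynomial-time computability (`polyTime_blow`). Structured stack programs with
a timed big-step semantics are compiled to multi-stack machines (`Runs.machine`,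
`polyTime_of_within`). The blow-up is computed by `k` passes, each of which expands the first
variable of every clause and moves it to the end (`iterate_copiesFirst`). -/

namespace PercCSP

/-! ### Structured programs on stacks and their compilation to multi-stack machines -/

/-- Structured programs acting on a register of type `σ` and on stacks indexed by `K`. -/
inductive Prog (K Γ σ : Type) : Type
  | push (s : K) (f : σ → Γ)
  | pop (s : K) (f : σ → Option Γ → σ)
  | load (f : σ → σ)
  | seq (p q : Prog K Γ σ)
  | loop (b : σ → Bool) (p : Prog K Γ σ)

namespace Prog

variable {K Γ σ : Type}

/-- The program points of a program. -/
def Lbl : Prog K Γ σ → Type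
  | push _ _ => Unit
  | pop _ _ => Unit
  | load _ => Unit
  | seq p q => p.Lbl ⊕ q.Lbl
  | loop _ p => Option p.Lbl

/-- There are finitely many program points. -/
@[reducible] def fintypeLbl : (p : Prog K Γ σ) → Fintype p.Lbl
  | push _ _ => inferInstanceAs (Fintype Unit)
  | pop _ _ => inferInstanceAs (Fintype Unit)
  | load _ => inferInstanceAs (Fintype Unit)
  | seq p q => @instFintypeSum _ _ p.fintypeLbl q.fintypeLbl
  | loop _ p => @instFintypeOption _ p.fintypeLbl

/-- The initial program point. -/
def entry : (p : Prog K Γ σ) → p.Lbl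
  | push _ _ => ()
  | pop _ _ => ()
  | load _ => ()
  | seq p _ => Sum.inl p.entry
  | loop _ _ => none

/-- The machine code of a program whose points are embedded in the label type `L` by `emb`, and
which continues at `exit`. -/
def code {L : Type} : (p : Prog K Γ σ) → (p.Lbl → L) → L → p.Lbl → TM2.Stmt (fun _ : K => Γ) L σ
  | push s f, _, exit => fun _ => .push s f (.goto fun _ => exit)
  | pop s f, _, exit => fun _ => .pop s f (.goto fun _ => exit)
  | load f, _, exit => fun _ => .load f (.goto fun _ => exit)
  | seq p q, emb, exit => fun l => match l with
    | Sum.inl a => p.code (fun a => emb (Sum.inl a)) (emb (Sum.inr q.entry)) a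
    | Sum.inr a => q.code (fun a => emb (Sum.inr a)) exit a
  | loop b p, emb, exit => fun l => match l with
    | none => .branch b (.goto fun _ => emb (some p.entry)) (.goto fun _ => exit)
    | some a => p.code (fun a => emb (some a)) (emb none) a

variable [DecidableEq K]

/-- Big-step semantics with running time. -/
inductive Runs : Prog K Γ σ → σ × (K → List Γ) → σ × (K → List Γ) → ℕ → Prop
  | push (s f v S) : Runs (push s f) (v, S) (v, Function.update S s (f v :: S s)) 1
  | pop (s f v S) :
      Runs (pop s f) (v, S) (f v (S s).head?, Function.update S s (S s).tail) 1
  | load (f v S) : Runs (load f) (v, S) (f v, S) 1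
  | seq {p q x y z t u} : Runs p x y t → Runs q y z u → Runs (seq p q) x z (t + u)
  | loop_false {b p v S} : b v = false → Runs (loop b p) (v, S) (v, S) 1
  | loop_true {b p v S y z t u} : b v = true → Runs p (v, S) y t → Runs (loop b p) y z u →
      Runs (loop b p) (v, S) z (1 + t + u)

/-- Each timed rule of the semantics is exactly one machine step, because jumps are part of the
statement executed. Keeping `emb` and `exit` arbitrary makes the induction work: the first half of a
sequence exits at the entry of the second, and a loop body exits at the test of its loop. -/
theorem Runs.machine {L : Type} {m : L → TM2.Stmt (fun _ : K => Γ) L σ}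
    {p : Prog K Γ σ} {x y : σ × (K → List Γ)} {t : ℕ} (h : Runs p x y t) :
    ∀ (emb : p.Lbl → L) (exit : L), (∀ a, m (emb a) = p.code emb exit a) →
      (flip Bind.bind (TM2.step m))^[t] (some ⟨some (emb p.entry), x.1, x.2⟩) =
        some ⟨some exit, y.1, y.2⟩ := by
  have key {l : L} {v : σ} {S : K → List Γ} {q : TM2.Stmt (fun _ : K => Γ) L σ}
      (hq : m l = q) : (flip Bind.bind (TM2.step m))^[1] (some ⟨some l, v, S⟩) =
        some (TM2.stepAux q v S) :=
    congrArg (fun q => some (TM2.stepAux q v S)) hq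
  induction h with
  | push s f v S => exact fun emb exit hm => key (hm ())
  | pop s f v S => exact fun emb exit hm => key (hm ())
  | load f v S => exact fun emb exit hm => key (hm ())
  | @seq p q x y z t u hp hq ihp ihq =>
    intro emb exit hm
    rw [add_comm, Function.iterate_add_apply]
    have h1 := ihp (fun a => emb (Sum.inl a)) (emb (Sum.inr q.entry)) fun a => hm (Sum.inl a)
    have h2 := ihq (fun a => emb (Sum.inr a)) exit fun a => hm (Sum.inr a)
    exact (congrArg _ h1).trans h2
  | @loop_false b p v S hb =>
    intro emb exit hm
    refine (key (hm none)).trans (congrArg some ?_)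
    change cond (b v) _ _ = _
    rw [hb]
    rfl
  | @loop_true b p v S y z t u hb hp hl ihp ihl =>
    intro emb exit hm
    have h0 : (flip Bind.bind (TM2.step m))^[1]
        (some ⟨some (emb (entry (loop b p))), v, S⟩) = some ⟨some (emb (some p.entry)), v, S⟩ := by
      refine (key (hm none)).trans (congrArg some ?_)
      change cond (b v) _ _ = _
      rw [hb]
      rfl
    have h1 := ihp (fun a => emb (some a)) (emb none) fun a => hm (some a)
    rw [add_comm, Function.iterate_add_apply, add_comm, Function.iterate_add_apply, h0, h1]
    exact ihl emb exit hm

/-- The program leads from `x` to `y` in at most `T` steps. -/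
def Within (p : Prog K Γ σ) (x y : σ × (K → List Γ)) (T : ℕ) : Prop := ∃ t ≤ T, Runs p x y t

theorem Within.mono {p : Prog K Γ σ} {x y : σ × (K → List Γ)} {T U : ℕ} (h : p.Within x y T)
    (hTU : T ≤ U) : p.Within x y U :=
  let ⟨t, ht, hr⟩ := h
  ⟨t, ht.trans hTU, hr⟩

theorem Within.seq {p q : Prog K Γ σ} {x y z : σ × (K → List Γ)} {T U : ℕ}
    (hp : p.Within x y T) (hq : q.Within y z U) : (p.seq q).Within x z (T + U) :=
  let ⟨_, ht, hr⟩ := hp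
  let ⟨_, hu, hs⟩ := hq
  ⟨_, add_le_add ht hu, hr.seq hs⟩

theorem within_push (s : K) (f : σ → Γ) (v : σ) (S : K → List Γ) :
    (push s f).Within (v, S) (v, Function.update S s (f v :: S s)) 1 :=
  ⟨1, le_rfl, .push s f v S⟩

theorem within_load (f : σ → σ) (v : σ) (S : K → List Γ) :
    (load f).Within (v, S) (f v, S) 1 :=
  ⟨1, le_rfl, .load f v S⟩

/-- The machine executing a program whose register is initially `v`. -/
def toTM [Fintype K] [Fintype Γ] [Fintype σ] (p : Prog K Γ σ) (v : σ) (k₀ k₁ : K) : FinTM2 where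
  K := K
  k₀ := k₀
  k₁ := k₁
  Γ := fun _ => Γ
  Λ := Option p.Lbl
  main := some p.entry
  ΛFin := @instFintypeOption _ p.fintypeLbl
  σ := σ
  initialState := v
  m := fun l => match l with
    | some a => p.code some none a
    | none => .halt

/-- A halting configuration must have the initial register value and no stack content except the
output. This is why programs have to clean up and return to `v`. -/
theorem polyTime_of_within [Fintype K] [Fintype Γ] [Fintype σ] {α β : Type} (ea : Encoding α Γ)
    (eb : Encoding β Γ) (f : α → β) (p : Prog K Γ σ) (v : σ) (k₀ k₁ : K) (P : Polynomial ℕ)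
    (h : ∀ a, p.Within (v, Function.update (fun _ => []) k₀ (ea.encode a))
      (v, Function.update (fun _ => []) k₁ (eb.encode (f a))) (P.eval (ea.encode a).length)) :
    PolyTime ea eb f := by
  refine ⟨{ tm := p.toTM v k₀ k₁, inputAlphabet := Equiv.refl Γ, outputAlphabet := Equiv.refl Γ,
            time := P + 1, outputsFun := fun a => ?_ }⟩
  apply Classical.choice
  obtain ⟨t, ht, hr⟩ := h a
  -- The additional step executes the `halt` statement at the label `none`.
  refine ⟨⟨⟨t + 1, ?_⟩, by simpa using ht⟩⟩
  have hin : initList (p.toTM v k₀ k₁) (List.map (Equiv.refl Γ).invFun (ea.encode a)) =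
      ⟨some (some p.entry), v, Function.update (fun _ => []) k₀ (ea.encode a)⟩ := by
    refine (congrArg (initList (p.toTM v k₀ k₁)) (List.map_id (ea.encode a))).trans ?_
    unfold initList
    congr 1
    refine funext fun (j : K) => ?_
    by_cases hj : j = k₀
    · refine (dif_pos hj).trans ?_
      subst hj
      exact (Function.update_self (f := fun _ => []) j (ea.encode a)).symm
    · exact (dif_neg hj).trans (Function.update_of_ne (f := fun _ => []) hj (ea.encode a)).symm
  have hout : haltList (p.toTM v k₀ k₁) (List.map (Equiv.refl Γ).invFun (eb.encode (f a))) =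
      ⟨none, v, Function.update (fun _ => []) k₁ (eb.encode (f a))⟩ := by
    refine (congrArg (haltList (p.toTM v k₀ k₁)) (List.map_id (eb.encode (f a)))).trans ?_
    unfold haltList
    congr 1
    refine funext fun (j : K) => ?_
    by_cases hj : j = k₁
    · refine (dif_pos hj).trans ?_
      subst hj
      exact (Function.update_self (f := fun _ => []) j (eb.encode (f a))).symm
    · exact (dif_neg hj).trans (Function.update_of_ne (f := fun _ => []) hj (eb.encode (f a))).symm
  have h1 := hr.machine (m := (p.toTM v k₀ k₁).m) some none fun a => rfl
  refine (congrArg (fun c => (flip Bind.bind (p.toTM v k₀ k₁).step)^[t + 1] (some c)) hin).trans ?_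
  refine Eq.trans ?_ (congrArg some hout).symm
  rw [add_comm, Function.iterate_add_apply]
  exact congrArg ((flip Bind.bind (p.toTM v k₀ k₁).step)^[1]) h1

/-! ### Loops that consume a stack, and their running times -/

section Macros

variable {K Γ : Type}

/-- Pop symbols from the stack `s` into the register, executing `body` after each of them, until
the register fails the test `b`. -/
def popWhile (s : K) (b : Option Γ → Bool) (body : Prog K Γ (Option Γ)) : Prog K Γ (Option Γ) :=
  (pop s fun _ o => o).seq (loop b (body.seq (pop s fun _ o => o)))

/-- Execute a program `n` times. -/
def repeatN {σ : Type} (p : Prog K Γ σ) : ℕ → Prog K Γ σ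
  | 0 => load id
  | n + 1 => p.seq (repeatN p n)

/-- Empty the stack `s`, pushing for each of its symbols the symbol computed by `f` onto `d`. -/
def pour (s d : K) (f : Option Γ → Γ) : Prog K Γ (Option Γ) :=
  popWhile s Option.isSome (push d f)

/-- Empty the stack `s`, pushing for each of its symbols the symbols computed by `f` and `g` onto
`d` and `e`. -/
def pourTwo (s d e : K) (f g : Option Γ → Γ) : Prog K Γ (Option Γ) :=
  popWhile s Option.isSome ((push d f).seq (push e g))

/-- Empty the stack `s`. -/
def clear (s : K) : Prog K Γ (Option Γ) := popWhile s Option.isSome (load id)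

variable [DecidableEq K]

theorem within_popWhile_stop {s : K} {b : Option Γ → Bool} (body : Prog K Γ (Option Γ))
    (v : Option Γ) (S : K → List Γ) (hb : b (S s).head? = false) :
    (popWhile s b body).Within (v, S) ((S s).head?, Function.update S s (S s).tail) 2 :=
  ⟨2, le_rfl, (Runs.pop s (fun _ o => o) v S).seq (.loop_false hb)⟩

/-- The pop that closes one iteration is also the opening pop of a fresh `popWhile`. Loops can thus
be analysed by induction on the stack content, with an overhead of two steps per symbol. -/
theorem within_popWhile_step {s : K} {b : Option Γ → Bool} {body : Prog K Γ (Option Γ)}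
    {v : Option Γ} {S : K → List Γ} {y z : Option Γ × (K → List Γ)} {B T : ℕ}
    (hb : b (S s).head? = true)
    (hbody : body.Within ((S s).head?, Function.update S s (S s).tail) y B)
    (hrest : (popWhile s b body).Within y z T) :
    (popWhile s b body).Within (v, S) z (B + 2 + T) := by
  obtain ⟨t, ht, hr⟩ := hbody
  obtain ⟨u, hu, hs⟩ := hrest
  cases hs with
  | @seq _ _ _ w _ t₁ t₂ hp hl =>
    exact ⟨1 + (1 + (t + t₁) + t₂), by omega,
      (Runs.pop s (fun _ o => o) v S).seq (.loop_true hb (hr.seq hp) hl)⟩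

theorem Within.of_eq {σ : Type} {p : Prog K Γ σ} {x : σ × (K → List Γ)} {v : σ} {S S' : K → List Γ}
    {T : ℕ} (h : p.Within x (v, S) T) (hS : S = S') : p.Within x (v, S') T := hS ▸ h

/-- Pouring reverses the order. A stack is therefore copied without loss by pouring it onto the
target and a scratch stack, and then pouring the scratch stack back. -/
theorem within_pour {s d : K} (hsd : s ≠ d) (f : Option Γ → Γ) : ∀ (l : List Γ) (v : Option Γ)
    (S : K → List Γ), S s = l → (pour s d f).Within (v, S)
      (none, Function.update (Function.update S s []) d ((l.map fun a => f (some a)).reverse ++ S d))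
      (3 * l.length + 2)
  | [], v, S, h => by
    have := within_popWhile_stop (s := s) (b := Option.isSome) (push d f) v S (by simp [h])
    rw [h] at this
    refine this.of_eq (funext fun j => ?_)
    by_cases hj : j = d
    · subst hj; simp [hsd.symm]
    · simp [hj]
  | a :: l, v, S, h => by
    have hb := within_push d f (some a) (Function.update S s l)
    have ih := within_pour hsd f l (some a)
      (Function.update (Function.update S s l) d (f (some a) :: S d))
      (by rw [Function.update_of_ne hsd, Function.update_self])
    have := within_popWhile_step (s := s) (b := Option.isSome) (v := v) (S := S)
      (body := push d f) (by simp [h]) (by rw [h]; exact hb)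
      (by rw [Function.update_of_ne hsd.symm]; exact ih)
    refine (this.mono (U := 3 * (a :: l).length + 2) (by simp; omega)).of_eq (funext fun j => ?_)
    by_cases hj : j = d
    · subst hj; simp
    · by_cases hj' : j = s
      · subst hj'; simp [hj]
      · simp [hj, hj']

theorem within_pourTwo {s d e : K} (hsd : s ≠ d) (hse : s ≠ e) (hde : d ≠ e) (f g : Option Γ → Γ) :
    ∀ (l : List Γ) (v : Option Γ) (S : K → List Γ), S s = l → (pourTwo s d e f g).Within (v, S)
      (none, Function.update (Function.update (Function.update S s []) d
        ((l.map fun a => f (some a)).reverse ++ S d)) e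
        ((l.map fun a => g (some a)).reverse ++ S e))
      (4 * l.length + 2)
  | [], v, S, h => by
    have := within_popWhile_stop (s := s) (b := Option.isSome) ((push d f).seq (push e g)) v S
      (by simp [h])
    rw [h] at this
    refine this.of_eq (funext fun j => ?_)
    by_cases hje : j = e
    · subst hje; simp [hse.symm]
    · by_cases hj : j = d
      · subst hj; simp [hsd.symm, hje]
      · simp [hj, hje]
  | a :: l, v, S, h => by
    have hb := (within_push d f (some a) (Function.update S s l)).seq (within_push e g (some a) _)
    have ih := within_pourTwo hsd hse hde f g l (some a)
      (Function.update (Function.update (Function.update S s l) d (f (some a) :: S d)) e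
        (g (some a) :: S e))
      (by rw [Function.update_of_ne hse, Function.update_of_ne hsd, Function.update_self])
    have := within_popWhile_step (s := s) (b := Option.isSome) (v := v) (S := S)
      (body := (push d f).seq (push e g)) (by simp [h]) (by rw [h]; exact hb)
      (by
        rw [Function.update_of_ne hsd.symm, Function.update_of_ne hde.symm,
          Function.update_of_ne hse.symm]
        exact ih)
    refine (this.mono (U := 4 * (a :: l).length + 2) (by simp; omega)).of_eq (funext fun j => ?_)
    by_cases hje : j = e
    · subst hje; simp
    · by_cases hj : j = d
      · subst hj; simp [hje]
      · by_cases hj' : j = s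
        · subst hj'; simp [hj, hje]
        · simp [hj, hj', hje]

theorem within_clear (s : K) : ∀ (l : List Γ) (v : Option Γ) (S : K → List Γ), S s = l →
    (clear s).Within (v, S) (none, Function.update S s []) (3 * l.length + 2)
  | [], v, S, h => by
    have := within_popWhile_stop (s := s) (b := Option.isSome) (load id) v S (by simp [h])
    simpa [h, clear] using this
  | a :: l, v, S, h => by
    have hb := within_load (K := K) (Γ := Γ) id (some a) (Function.update S s l)
    have ih := within_clear s l (some a) (Function.update S s l) (by simp)
    have := within_popWhile_step (s := s) (b := Option.isSome) (v := v) (S := S)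
      (body := load id) (by simp [h]) (by rw [h]; exact hb) ih
    rw [Function.update_idem] at this
    exact this.mono (by simp; omega)

end Macros

end Prog

/-! ### A program for blow-ups of instances -/

/-- The stacks used by the blow-up program: input and output, the blow-up factor, the number of
variables, and auxiliary stacks. -/
inductive Stk
  | inp | fac | num | rev | var | out | tmp | cls
  deriving DecidableEq

instance : Fintype Stk :=
  ⟨{.inp, .fac, .num, .rev, .var, .out, .tmp, .cls}, fun s => by cases s <;> decide⟩

/-- The stacks with the given contents. -/
def st {Γ : Type} (i q h r w o t e : List Γ) : Stk → List Γ
  | .inp => i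
  | .fac => q
  | .num => h
  | .rev => r
  | .var => w
  | .out => o
  | .tmp => t
  | .cls => e

section

variable {Γ : Type} (i q h r w o t e x : List Γ)

@[simp] theorem st_inp : st i q h r w o t e .inp = i := rfl
@[simp] theorem st_fac : st i q h r w o t e .fac = q := rfl
@[simp] theorem st_num : st i q h r w o t e .num = h := rfl
@[simp] theorem st_rev : st i q h r w o t e .rev = r := rfl
@[simp] theorem st_var : st i q h r w o t e .var = w := rfl
@[simp] theorem st_out : st i q h r w o t e .out = o := rfl
@[simp] theorem st_tmp : st i q h r w o t e .tmp = t := rfl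
@[simp] theorem st_cls : st i q h r w o t e .cls = e := rfl

@[simp] theorem update_st_inp :
    Function.update (st i q h r w o t e) .inp x = st x q h r w o t e := by
  funext s; cases s <;> rfl
@[simp] theorem update_st_fac :
    Function.update (st i q h r w o t e) .fac x = st i x h r w o t e := by
  funext s; cases s <;> rfl
@[simp] theorem update_st_num :
    Function.update (st i q h r w o t e) .num x = st i q x r w o t e := by
  funext s; cases s <;> rfl
@[simp] theorem update_st_rev :
    Function.update (st i q h r w o t e) .rev x = st i q h x w o t e := by
  funext s; cases s <;> rfl
@[simp] theorem update_st_var :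
    Function.update (st i q h r w o t e) .var x = st i q h r x o t e := by
  funext s; cases s <;> rfl
@[simp] theorem update_st_out :
    Function.update (st i q h r w o t e) .out x = st i q h r w x t e := by
  funext s; cases s <;> rfl
@[simp] theorem update_st_tmp :
    Function.update (st i q h r w o t e) .tmp x = st i q h r w o x e := by
  funext s; cases s <;> rfl
@[simp] theorem update_st_cls :
    Function.update (st i q h r w o t e) .cls x = st i q h r w o t x := by
  funext s; cases s <;> rfl

end

open Prog

variable {k : ℕ}

/-- The unary digit. -/
abbrev digit (k : ℕ) : Symbol k := Sum.inl true

/-- The end marker. -/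
abbrev marker (k : ℕ) : Symbol k := Sum.inl false

/-- The number `n` in unary, without end marker. -/
abbrev digits (k n : ℕ) : List (Symbol k) := List.replicate n (digit k)

/-- The register contains a unary digit. -/
def isDigit : Option (Symbol k) → Bool
  | some (Sum.inl true) => true
  | _ => false

/-- The symbol in the register. -/
def current (v : Option (Symbol k)) : Symbol k := v.getD (digit k)

/-- Add the number on the stack `fac` to the one on the stack `var`. -/
def addFac (k : ℕ) : Prog Stk (Symbol k) (Option (Symbol k)) :=
  (pourTwo .fac .var .tmp (fun _ => digit k) fun _ => digit k).seq (pour .tmp .fac fun _ => digit k)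

/-- Multiply the number on the stack `num` by the one on the stack `fac`. -/
def mulNum (k : ℕ) : Prog Stk (Symbol k) (Option (Symbol k)) :=
  (popWhile .num Option.isSome (addFac k)).seq (pour .var .num fun _ => digit k)

/-- Read a number and add its product with the number on `fac` to the one on `var`. -/
def readMul (k : ℕ) : Prog Stk (Symbol k) (Option (Symbol k)) :=
  popWhile .inp isDigit (addFac k)

/-- Read a number and store it on `rev`. -/
def readNum (k : ℕ) : Prog Stk (Symbol k) (Option (Symbol k)) :=
  (popWhile .inp isDigit (push .rev fun _ => digit k)).seq (push .rev fun _ => marker k)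

/-- Write the contents of `cls` and the number on `var`, and increment the latter. -/
def emit (k : ℕ) : Prog Stk (Symbol k) (Option (Symbol k)) :=
  (push .tmp fun _ => digit k).seq <|
  (pourTwo .cls .out .rev current current).seq <| (pour .rev .cls current).seq <|
  (pourTwo .var .out .rev (fun _ => digit k) fun _ => digit k).seq <| (pour .rev .var fun _ => digit k).seq <|
  (push .out fun _ => marker k).seq (push .var fun _ => digit k)

/-- Write as many clauses as the number on `fac` says. -/
def emitAll (k : ℕ) : Prog Stk (Symbol k) (Option (Symbol k)) :=
  popWhile .fac Option.isSome (emit k)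

/-- Replace a clause with `r + 1` variables, the predicate of which is in the register, by copies in
which its first variable is replaced by its copies, which come last. -/
def blowClause (k r : ℕ) : Prog Stk (Symbol k) (Option (Symbol k)) :=
  (push .rev current).seq <| (readMul k).seq <| (repeatN (readNum k) r).seq <|
  (pour .rev .cls current).seq <| (emitAll k).seq <| (pour .tmp .fac fun _ => digit k).seq <|
  (Prog.clear .cls).seq (Prog.clear .var)

/-- Apply `blowClause` to all clauses. -/
def blowFirst (k r : ℕ) : Prog Stk (Symbol k) (Option (Symbol k)) :=
  (popWhile .inp Option.isSome (blowClause k r)).seq (pour .out .inp current)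

/-- Blow up the whole instance. -/
def blowAll (k : ℕ) : Prog Stk (Symbol k) (Option (Symbol k)) :=
  (mulNum k).seq (repeatN (blowFirst k (k - 1)) k)

/-- Prepare the stacks. -/
def initProg (k : ℕ) : Prog Stk (Symbol k) (Option (Symbol k)) :=
  (pourTwo .inp .out .fac current fun _ => digit k).seq <|
  (pour .out .inp current).seq (popWhile .inp isDigit (push .num fun _ => digit k))

/-- Write the number of variables in front of the clauses and clean up. -/
def finishProg (k : ℕ) : Prog Stk (Symbol k) (Option (Symbol k)) :=
  (push .inp fun _ => marker k).seq <| (pour .num .inp fun _ => digit k).seq (Prog.clear .fac)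

/-- The program blowing up an instance `c` times, each time by the length of its encoding. -/
def blowProg (k c : ℕ) : Prog Stk (Symbol k) (Option (Symbol k)) :=
  (initProg k).seq ((repeatN (blowAll k) c).seq (finishProg k))

/-! ### Correctness of the program -/

theorem length_encUnary (n : ℕ) : (encUnary k n).length = n + 1 := by simp [encUnary]

theorem digits_succ (a : ℕ) : digits k (a + 1) = digit k :: digits k a := rfl

theorem within_addFac (v : Option (Symbol k)) (q w : ℕ) (i h r o e : List (Symbol k)) :
    (addFac k).Within (v, st i (digits k q) h r (digits k w) o [] e)
      (none, st i (digits k q) h r (digits k (w + q)) o [] e) (7 * q + 4) := by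
  have h1 := (within_pourTwo (K := Stk) (s := .fac) (d := .var) (e := .tmp) (by decide)
    (by decide) (by decide) (fun _ => digit k) (fun _ => digit k) (digits k q) v
    (st i (digits k q) h r (digits k w) o [] e) rfl).of_eq
    (S' := st i [] h r (digits k (w + q)) o (digits k q) e)
    (by simp [add_comm w q])
  have h2 := (within_pour (K := Stk) (s := .tmp) (d := .fac) (by decide)
    (fun _ => digit k) (digits k q) none
    (st i [] h r (digits k (w + q)) o (digits k q) e) rfl).of_eq
    (S' := st i (digits k q) h r (digits k (w + q)) o [] e) (by simp)
  exact (h1.seq h2).mono (by simp; omega)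

theorem within_mulNum (v : Option (Symbol k)) (q n : ℕ) (i r o e : List (Symbol k)) :
    (mulNum k).Within (v, st i (digits k q) (digits k n) r [] o [] e)
      (none, st i (digits k q) (digits k (n * q)) r [] o [] e) (10 * (n + 1) * (q + 1)) := by
  have key : ∀ (n w : ℕ) (v : Option (Symbol k)),
      (popWhile .num Option.isSome (addFac k)).Within
        (v, st i (digits k q) (digits k n) r (digits k w) o [] e)
        (none, st i (digits k q) [] r (digits k (w + n * q)) o [] e) (n * (7 * q + 6) + 2) := by
    intro n
    induction n with
    | zero =>
      intro w v
      have := within_popWhile_stop (s := Stk.num) (b := Option.isSome) (addFac k) v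
        (st i (digits k q) (digits k 0) r (digits k w) o [] e) rfl
      simpa using this
    | succ n ih =>
      intro w v
      have h1 := within_addFac (some (digit k)) q w i (digits k n) r o e
      have := within_popWhile_step (s := Stk.num) (b := Option.isSome) (v := v)
        (S := st i (digits k q) (digits k (n + 1)) r (digits k w) o [] e) rfl
        (by simpa [digits_succ] using h1) (ih (w + q) none)
      rw [show w + (n + 1) * q = w + q + n * q by ring]
      exact this.mono (by nlinarith)
  have h1 := key n 0 v
  have h2 := (within_pour (K := Stk) (s := .var) (d := .num) (by decide)
    (fun _ => digit k) (digits k (0 + n * q)) none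
    (st i (digits k q) [] r (digits k (0 + n * q)) o [] e) rfl).of_eq
    (S' := st i (digits k q) (digits k (n * q)) r [] o [] e) (by simp)
  exact (h1.seq h2).mono (by simp; nlinarith)

theorem within_readMul (q : ℕ) (h r o e rest : List (Symbol k)) : ∀ (u w : ℕ)
    (v : Option (Symbol k)),
    (readMul k).Within
      (v, st (encUnary k u ++ rest) (digits k q) h r (digits k w) o [] e)
      (some (marker k), st rest (digits k q) h r (digits k (w + u * q)) o [] e)
      (u * (7 * q + 6) + 2)
  | 0, w, v => by
    have := within_popWhile_stop (s := Stk.inp) (b := isDigit) (addFac k) v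
      (st (encUnary k 0 ++ rest) (digits k q) h r (digits k w) o [] e) rfl
    simpa [encUnary, readMul] using this
  | u + 1, w, v => by
    have h1 := within_addFac (some (digit k)) q w (encUnary k u ++ rest) h r o e
    have := within_popWhile_step (s := Stk.inp) (b := isDigit) (v := v)
      (S := st (encUnary k (u + 1) ++ rest) (digits k q) h r (digits k w) o [] e) rfl
      (by simpa [encUnary, List.replicate_succ] using h1)
      (within_readMul q h r o e rest u (w + q) none)
    rw [show w + (u + 1) * q = w + q + u * q by ring]
    exact this.mono (by nlinarith)

theorem within_readDigits (s : Stk) (hs : s ≠ .inp) (rest : List (Symbol k)) : ∀ (u : ℕ)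
    (v : Option (Symbol k)) (S : Stk → List (Symbol k)), S .inp = encUnary k u ++ rest →
    (popWhile .inp isDigit (push s fun _ => digit k)).Within (v, S)
      (some (marker k), Function.update (Function.update S .inp rest) s (digits k u ++ S s))
      (3 * u + 2)
  | 0, v, S, hS => by
    have := within_popWhile_stop (s := Stk.inp) (b := isDigit) (push s fun _ => digit k) v S
      (by rw [hS]; rfl)
    rw [hS] at this
    refine this.of_eq ?_
    funext j
    by_cases hj : j = s
    · subst hj; simp [hs]
    · simp [hj, encUnary]
  | u + 1, v, S, hS => by
    have h0 : S .inp = digit k :: (encUnary k u ++ rest) := hS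
    have h1 := within_push s (fun _ => digit k) (some (digit k))
      (Function.update S .inp (encUnary k u ++ rest))
    have := within_popWhile_step (s := Stk.inp) (b := isDigit) (v := v) (S := S)
      (body := push s fun _ => digit k) (by rw [h0]; rfl) (by rw [h0]; exact h1)
      (within_readDigits s hs rest u (some (digit k)) _
        (by rw [Function.update_of_ne hs.symm, Function.update_self]))
    refine (this.mono (by omega)).of_eq ?_
    funext j
    by_cases hj : j = s
    · subst hj
      rw [Function.update_self, Function.update_self, Function.update_self,
        Function.update_of_ne hs, show digits k (u + 1) = digits k u ++ [digit k] from
          List.replicate_succ', List.append_assoc]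
      rfl
    · by_cases hj' : j = .inp
      · subst hj'; simp [hj]
      · simp [hj, hj']

theorem within_readNums (q h w o t e rest : List (Symbol k)) : ∀ (us : List ℕ)
    (r : List (Symbol k)) (v : Option (Symbol k)), ∃ v',
    (repeatN (readNum k) us.length).Within
      (v, st (us.flatMap (encUnary k) ++ rest) q h r w o t e)
      (v', st rest q h ((us.flatMap (encUnary k)).reverse ++ r) w o t e)
      (3 * (us.flatMap (encUnary k)).length + 1)
  | [], r, v => ⟨v, within_load id v _⟩
  | u :: us, r, v => by
    have h1 := (within_readDigits .rev (by decide) (us.flatMap (encUnary k) ++ rest) u v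
      (st ((u :: us).flatMap (encUnary k) ++ rest) q h r w o t e) (by simp)).seq
      (within_push .rev (fun _ => marker k) _ _)
    obtain ⟨v', h2⟩ := within_readNums q h w o t e rest us
      ((encUnary k u).reverse ++ r) (some (marker k))
    refine ⟨v', ?_⟩
    have h3 := (h1.of_eq (S' := st (us.flatMap (encUnary k) ++ rest) q h
      ((encUnary k u).reverse ++ r) w o t e) (by simp [encUnary])).seq h2
    refine (h3.mono ?_).of_eq (by simp)
    simp [encUnary]
    omega

/-- The stacks `cls` and `var` survive by way of `rev`, which must be empty at the start. The digit
left on `tmp` records one use of `fac`, so that `fac` can be rebuilt later. Output accumulates in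
reverse on `out`. -/
theorem within_emit (v : Option (Symbol k)) (w : ℕ) (i q h o t e : List (Symbol k)) :
    (emit k).Within (v, st i q h [] (digits k w) o t e)
      (none, st i q h [] (digits k (w + 1)) ((e ++ encUnary k w).reverse ++ o) (digit k :: t) e)
      (7 * (e.length + w) + 11) := by
  have h1 := (within_push Stk.tmp (fun _ => digit k) v
    (st i q h [] (digits k w) o t e)).of_eq
    (S' := st i q h [] (digits k w) o (digit k :: t) e) (by simp)
  have hc : ∀ a : Symbol k, current (some a) = a := fun a => rfl
  have h2 := (within_pourTwo (K := Stk) (s := .cls) (d := .out) (e := .rev) (by decide)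
    (by decide) (by decide) current current e v (st i q h [] (digits k w) o (digit k :: t) e) rfl).of_eq
    (S' := st i q h e.reverse (digits k w) (e.reverse ++ o) (digit k :: t) []) (by simp [hc])
  have h3 := (within_pour (K := Stk) (s := .rev) (d := .cls) (by decide) current e.reverse none
    (st i q h e.reverse (digits k w) (e.reverse ++ o) (digit k :: t) []) rfl).of_eq
    (S' := st i q h [] (digits k w) (e.reverse ++ o) (digit k :: t) e) (by simp [hc])
  have h4 := (within_pourTwo (K := Stk) (s := .var) (d := .out) (e := .rev) (by decide)
    (by decide) (by decide) (fun _ => digit k) (fun _ => digit k) (digits k w) none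
    (st i q h [] (digits k w) (e.reverse ++ o) (digit k :: t) e) rfl).of_eq
    (S' := st i q h (digits k w) [] (digits k w ++ (e.reverse ++ o)) (digit k :: t) e) (by simp)
  have h5 := (within_pour (K := Stk) (s := .rev) (d := .var) (by decide) (fun _ => digit k)
    (digits k w) none
    (st i q h (digits k w) [] (digits k w ++ (e.reverse ++ o)) (digit k :: t) e) rfl).of_eq
    (S' := st i q h [] (digits k w) (digits k w ++ (e.reverse ++ o)) (digit k :: t) e) (by simp)
  have h6 := (within_push Stk.out (fun _ => marker k) (none : Option (Symbol k))
    (st i q h [] (digits k w) (digits k w ++ (e.reverse ++ o)) (digit k :: t) e)).of_eq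
    (S' := st i q h [] (digits k w) ((e ++ encUnary k w).reverse ++ o) (digit k :: t) e)
    (by simp [encUnary])
  have h7 := (within_push Stk.var (fun _ => digit k) (none : Option (Symbol k))
    (st i q h [] (digits k w) ((e ++ encUnary k w).reverse ++ o) (digit k :: t) e)).of_eq
    (S' := st i q h [] (digits k (w + 1)) ((e ++ encUnary k w).reverse ++ o) (digit k :: t) e)
    (by simp [digits_succ])
  refine (h1.seq (h2.seq (h3.seq (h4.seq (h5.seq (h6.seq h7)))))).mono ?_
  simp
  omega

/-- The cost of an emission grows with `w`, but `w + a` is constant along the loop, so a single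
bound `B` covers all iterations. -/
theorem within_emitAll (i h e : List (Symbol k)) (B : ℕ) : ∀ (a b w : ℕ) (o : List (Symbol k))
    (v : Option (Symbol k)), 7 * (e.length + (w + a)) + 13 ≤ B →
    (emitAll k).Within (v, st i (digits k a) h [] (digits k w) o (digits k b) e)
      (none, st i [] h [] (digits k (w + a))
        (((List.range a).flatMap fun j => e ++ encUnary k (w + j)).reverse ++ o)
        (digits k (b + a)) e)
      (a * B + 2)
  | 0, b, w, o, v, _ => by
    have := within_popWhile_stop (s := Stk.fac) (b := Option.isSome) (emit k) v
      (st i (digits k 0) h [] (digits k w) o (digits k b) e) rfl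
    simpa [emitAll] using this
  | a + 1, b, w, o, v, hB => by
    have h1 := within_emit (some (digit k)) w i (digits k a) h o (digits k b) e
    have := within_popWhile_step (s := Stk.fac) (b := Option.isSome) (v := v)
      (S := st i (digits k (a + 1)) h [] (digits k w) o (digits k b) e) rfl
      (by simpa [digits_succ] using h1)
      (within_emitAll i h e B a (b + 1) (w + 1) _ none (by omega))
    refine (this.mono ?_).of_eq ?_
    · nlinarith
    · rw [show w + 1 + a = w + (a + 1) by ring, show b + 1 + a = b + (a + 1) by ring,
        List.range_succ_eq_map, List.flatMap_cons, List.flatMap_map, List.reverse_append,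
        List.append_assoc]
      simp [add_assoc, add_comm 1]

/-- The encoding of a clause given by its predicate and the list of its variables. -/
def encPair (C : BoolPred k × List ℕ) : List (Symbol k) :=
  Sum.inr C.1 :: C.2.flatMap (encUnary k)

/-- Replace the first variable of a clause by its `N` copies, which come last. -/
def copiesFirst (N : ℕ) : BoolPred k × List ℕ → List (BoolPred k × List ℕ)
  | (p, []) => [(p, [])]
  | (p, u :: us) => (List.range N).map fun j => (p, us ++ [u * N + j])

theorem encPair_append (p : BoolPred k) (us : List ℕ) (w : ℕ) :
    encPair (p, us ++ [w]) = encPair (p, us) ++ encUnary k w := by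
  simp [encPair]

theorem within_blowClause (q u : ℕ) (p : BoolPred k) (us : List ℕ) (h o rest : List (Symbol k)) :
    (blowClause k us.length).Within
      (some (Sum.inr p), st ((u :: us).flatMap (encUnary k) ++ rest) (digits k q) h [] [] o [] [])
      (none, st rest (digits k q) h [] []
        (((copiesFirst q (p, u :: us)).flatMap encPair).reverse ++ o) [] [])
      (60 * (encPair (p, u :: us)).length * (q + 1) ^ 2) := by
  have hc : ∀ a : Symbol k, current (some a) = a := fun a => rfl
  have h1 := (within_push Stk.rev current (some (Sum.inr p))
    (st ((u :: us).flatMap (encUnary k) ++ rest) (digits k q) h [] [] o [] [])).of_eq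
    (S' := st (encUnary k u ++ (us.flatMap (encUnary k) ++ rest)) (digits k q) h [Sum.inr p]
      (digits k 0) o [] []) (by simp [hc])
  have h2 := within_readMul q h [Sum.inr p] o [] (us.flatMap (encUnary k) ++ rest) u 0
    (some (Sum.inr p))
  obtain ⟨v, h3⟩ := within_readNums (digits k q) h (digits k (0 + u * q)) o [] [] rest us
    [Sum.inr p] (some (marker k))
  have h4 := (within_pour (K := Stk) (s := .rev) (d := .cls) (by decide) current _ v
    (st rest (digits k q) h ((us.flatMap (encUnary k)).reverse ++ [Sum.inr p])
      (digits k (0 + u * q)) o [] []) rfl).of_eq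
    (S' := st rest (digits k q) h [] (digits k (0 + u * q)) o (digits k 0) (encPair (p, us)))
    (by simp [hc, encPair])
  have h5 := within_emitAll rest h (encPair (p, us)) _ q 0 (0 + u * q) o none le_rfl
  have h6 := (within_pour (K := Stk) (s := .tmp) (d := .fac) (by decide) (fun _ => digit k) _ none
    (st rest [] h [] (digits k (0 + u * q + q))
        (((List.range q).flatMap fun j => encPair (p, us) ++ encUnary k (0 + u * q + j)).reverse
          ++ o)
        (digits k (0 + q)) (encPair (p, us))) rfl).of_eq
    (S' := st rest (digits k q) h [] (digits k (0 + u * q + q))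
      (((copiesFirst q (p, u :: us)).flatMap encPair).reverse ++ o) [] (encPair (p, us)))
    (by simp [copiesFirst, encPair_append, List.flatMap_map])
  have h7 := (within_clear Stk.cls _ none (st rest (digits k q) h [] (digits k (0 + u * q + q))
      (((copiesFirst q (p, u :: us)).flatMap encPair).reverse ++ o) [] (encPair (p, us)))
      rfl).of_eq (S' := st rest (digits k q) h [] (digits k (0 + u * q + q))
      (((copiesFirst q (p, u :: us)).flatMap encPair).reverse ++ o) [] []) (by simp)
  have h8 := (within_clear Stk.var _ none (st rest (digits k q) h [] (digits k (0 + u * q + q))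
      (((copiesFirst q (p, u :: us)).flatMap encPair).reverse ++ o) [] [])
      rfl).of_eq (S' := st rest (digits k q) h [] []
      (((copiesFirst q (p, u :: us)).flatMap encPair).reverse ++ o) [] []) (by simp)
  refine (h1.seq (h2.seq (h3.seq (h4.seq (h5.seq (h6.seq (h7.seq h8))))))).mono ?_
  simp only [encPair, List.flatMap_cons, List.length_append, List.length_cons, List.length_reverse,
    List.length_replicate, length_encUnary, List.length_nil, zero_add, st_rev, st_tmp, st_cls,
    st_var]
  generalize (us.flatMap (encUnary k)).length = x
  nlinarith [Nat.zero_le (u * q), Nat.zero_le (x * q), Nat.zero_le (x * q ^ 2),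
    Nat.zero_le (u * q ^ 2), Nat.zero_le q, Nat.zero_le u, Nat.zero_le x]

/-! ### Blow-ups of instances -/

/-- The list of all `k`-tuples of elements of `Fin N`. -/
def allTuples (N : ℕ) : (k : ℕ) → List (Fin k → Fin N)
  | 0 => [Fin.elim0]
  | k + 1 => (List.finRange N).flatMap fun a => (allTuples N k).map (Fin.cons a)

/-- The clause obtained by replacing each variable by one of its `N` copies. -/
def Clause.copy {n N : ℕ} (C : Clause k n) (j : Fin k → Fin N) : Clause k (n * N) where
  pred := C.pred
  vars := ⟨fun l => finProdFinEquiv (C.vars l, j l), fun _ _ h =>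
    C.vars.injective (congrArg Prod.fst (finProdFinEquiv.injective h))⟩

/-- The blow-up of an instance: each variable is replaced by `N` copies, and each clause by all
clauses on the copies of its variables. -/
def blow (N : ℕ) (Φ : CSP k) : CSP k where
  numVars := Φ.numVars * N
  clauses := Φ.clauses.flatMap fun C => (allTuples N k).map C.copy

/-- A clause as a pair of its predicate and the list of its variables. -/
def Clause.toPair {n : ℕ} (C : Clause k n) : BoolPred k × List ℕ :=
  (C.pred, List.ofFn fun l => (C.vars l : ℕ))

/-- All lists obtained from a list of variables by replacing each one by one of its `N` copies. -/
def listCopies (N : ℕ) : List ℕ → List (List ℕ)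
  | [] => [[]]
  | u :: us => (List.range N).flatMap fun j => (listCopies N us).map ((u * N + j) :: ·)

theorem map_allTuples (N : ℕ) : ∀ {k : ℕ} (u : Fin k → ℕ),
    (allTuples N k).map (fun j => List.ofFn fun l => u l * N + j l) = listCopies N (List.ofFn u)
  | 0, u => by simp [allTuples, listCopies]
  | k + 1, u => by
    rw [List.ofFn_succ, listCopies, ← map_allTuples N fun l => u l.succ, allTuples,
      List.map_flatMap, ← List.map_coe_finRange_eq_range, List.flatMap_map]
    refine List.flatMap_congr fun a _ => ?_
    simp [Function.comp_def, List.ofFn_succ]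

theorem iterate_flatMap_append {α : Type} (f : α → List α) (m : ℕ) : ∀ l l' : List α,
    (fun L : List α => L.flatMap f)^[m] (l ++ l') =
      (fun L : List α => L.flatMap f)^[m] l ++ (fun L : List α => L.flatMap f)^[m] l' := by
  induction m with
  | zero => intro l l'; rfl
  | succ m ih =>
    intro l l'
    simp only [Function.iterate_succ_apply, List.flatMap_append]
    exact ih _ _

theorem iterate_flatMap_eq {α β : Type} (f : α → List α) (m : ℕ) (g : β → List α) (l : List β) :
    (fun L : List α => L.flatMap f)^[m] (l.flatMap g) =
      l.flatMap fun a => (fun L : List α => L.flatMap f)^[m] (g a) := by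
  induction l with
  | nil =>
    rw [List.flatMap_nil, List.flatMap_nil]
    induction m with
    | zero => rfl
    | succ m ih => rw [Function.iterate_succ_apply, List.flatMap_nil, ih]
  | cons a l ih => rw [List.flatMap_cons, List.flatMap_cons, iterate_flatMap_append, ih]

/-- The list splits into variables still to be expanded and copies already chosen. Each pass moves
one entry across, and after `us.length` passes the original cyclic order has advanced past all of
`us`, so with `done` empty the order is restored. -/
theorem iterate_copiesFirst (N : ℕ) (p : BoolPred k) : ∀ us done : List ℕ,
    (fun L => L.flatMap (copiesFirst N))^[us.length] [(p, us ++ done)] =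
      (listCopies N us).map fun t => (p, done ++ t)
  | [], done => by simp [listCopies]
  | u :: us, done => by
    rw [List.length_cons, Function.iterate_succ_apply, List.flatMap_singleton, List.cons_append,
      copiesFirst, ← List.flatMap_singleton' (List.map _ _), List.flatMap_map, iterate_flatMap_eq,
      listCopies, List.map_flatMap]
    refine List.flatMap_congr fun j _ => ?_
    rw [List.append_assoc, iterate_copiesFirst N p us]
    simp

theorem iterate_copiesFirst_clauses (N : ℕ) (Φ : CSP k) :
    (fun L => L.flatMap (copiesFirst N))^[k] (Φ.clauses.map Clause.toPair) =
      (blow N Φ).clauses.map Clause.toPair := by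
  rw [← List.flatMap_singleton' (List.map _ _), List.flatMap_map, iterate_flatMap_eq, blow,
    List.map_flatMap]
  refine List.flatMap_congr fun C _ => ?_
  have h := iterate_copiesFirst N C.pred (List.ofFn fun l => (C.vars l : ℕ)) []
  rw [List.length_ofFn, List.append_nil, ← map_allTuples] at h
  rw [show C.toPair = (C.pred, List.ofFn fun l => (C.vars l : ℕ)) from rfl, h, List.map_map,
    List.map_map]
  refine List.map_congr_left fun j _ => ?_
  simp only [Function.comp_apply, List.nil_append, Clause.toPair, Prod.mk.injEq]
  refine ⟨rfl, congrArg List.ofFn (funext fun l => ?_)⟩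
  -- `finProdFinEquiv (v, j)` has value `j + N * v`, whereas the program computes `v * N + j`.
  rw [add_comm, mul_comm]
  rfl

/-! ### The blow-up program computes iterated blow-ups -/

theorem eval_mono (P : Polynomial ℕ) {a b : ℕ} (h : a ≤ b) : P.eval a ≤ P.eval b := by
  rw [Polynomial.eval_eq_sum, Polynomial.eval_eq_sum]
  exact Finset.sum_le_sum fun i _ => Nat.mul_le_mul_left _ (Nat.pow_le_pow_left h i)

/-- The number `m` of repetitions does not depend on the input, so composing the polynomial size
bounds `m` times still gives a polynomial. The parameter `q` stays fixed and is counted in the size.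
-/
theorem exists_within_repeatN {K Γ σ X : Type} [DecidableEq K] (S : ℕ → X → K → List Γ)
    (size : X → ℕ) (f : ℕ → X → X) (p : Prog K Γ σ) (inv : X → Prop)
    (hinv : ∀ q x, inv x → inv (f q x)) (P : Polynomial ℕ)
    (h : ∀ q x v, inv x → (∃ v', p.Within (v, S q x) (v', S q (f q x)) (P.eval (q + size x))) ∧
      size (f q x) ≤ P.eval (q + size x)) (m : ℕ) :
    ∃ Q : Polynomial ℕ, ∀ q x v, inv x →
      (∃ v', (repeatN p m).Within (v, S q x) (v', S q ((f q)^[m] x)) (Q.eval (q + size x))) ∧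
      size ((f q)^[m] x) ≤ Q.eval (q + size x) := by
  induction m with
  | zero =>
    refine ⟨Polynomial.X + 1, fun q x v _ => ⟨⟨v, (within_load id v _).mono ?_⟩, ?_⟩⟩
    · simp
    · simp; omega
  | succ m ih =>
    obtain ⟨Q, hQ⟩ := ih
    refine ⟨P + Q.comp (Polynomial.X + P), fun q x v hx => ?_⟩
    obtain ⟨⟨v₁, h₁⟩, h₂⟩ := h q x v hx
    obtain ⟨⟨v₂, h₃⟩, h₄⟩ := hQ q (f q x) v₁ (hinv q x hx)
    have hle : Q.eval (q + size (f q x)) ≤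
        (Q.comp (Polynomial.X + P)).eval (q + size x) := by
      rw [Polynomial.eval_comp]
      refine eval_mono Q ?_
      simp
      omega
    refine ⟨⟨v₂, ?_⟩, ?_⟩
    · rw [Function.iterate_succ_apply, Polynomial.eval_add]
      exact (h₁.seq h₃).mono (by omega)
    · rw [Function.iterate_succ_apply, Polynomial.eval_add]
      omega

theorem length_copiesFirst_le (q : ℕ) (C : BoolPred k × List ℕ) :
    ((copiesFirst q C).flatMap encPair).length ≤ 2 * (q + 1) ^ 2 * (encPair C).length := by
  obtain ⟨p, us⟩ := C
  cases us with
  | nil =>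
    have := Nat.one_le_pow 2 (q + 1) (by omega)
    simp [copiesFirst, encPair]
    omega
  | cons u us =>
    rw [copiesFirst, List.flatMap_map, List.length_flatMap]
    refine (List.sum_le_card_nsmul _ ((encPair (p, us)).length + (u * q + q + 1)) ?_).trans ?_
    · intro x hx
      obtain ⟨j, hj, rfl⟩ := List.mem_map.1 hx
      have := List.mem_range.1 hj
      rw [encPair_append, List.length_append, length_encUnary]
      omega
    · simp only [encPair, List.flatMap_cons, List.length_append, List.length_cons, List.length_map,
        List.length_range, length_encUnary, smul_eq_mul]
      generalize (us.flatMap (encUnary k)).length = x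
      nlinarith [Nat.zero_le (u * q), Nat.zero_le (x * q), Nat.zero_le (x * q ^ 2),
        Nat.zero_le (u * q ^ 2)]

theorem length_of_mem_copiesFirst {q : ℕ} {C D : BoolPred k × List ℕ} (h : D ∈ copiesFirst q C) :
    D.2.length = C.2.length := by
  obtain ⟨p, us⟩ := C
  cases us with
  | nil => simp_all [copiesFirst]
  | cons u us =>
    obtain ⟨j, -, rfl⟩ := List.mem_map.1 h
    simp

theorem length_flatMap_copiesFirst_le (q : ℕ) : ∀ L : List (BoolPred k × List ℕ),
    ((L.flatMap (copiesFirst q)).flatMap encPair).length ≤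
      2 * (q + 1) ^ 2 * (L.flatMap encPair).length
  | [] => by simp
  | C :: L => by
    have h1 := length_copiesFirst_le q C
    have h2 := length_flatMap_copiesFirst_le q L
    simp only [List.flatMap_cons, List.flatMap_append, List.length_append, mul_add]
    exact add_le_add h1 h2

theorem within_blowFirst (r q : ℕ) (h : List (Symbol k)) (L : List (BoolPred k × List ℕ))
    (hL : ∀ C ∈ L, C.2.length = r + 1) (v : Option (Symbol k)) :
    (blowFirst k r).Within (v, st (L.flatMap encPair) (digits k q) h [] [] [] [] [])
      (none, st ((L.flatMap (copiesFirst q)).flatMap encPair) (digits k q) h [] [] [] [] [])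
      (80 * ((L.flatMap encPair).length + 1) * (q + 1) ^ 2) := by
  have key : ∀ (L : List (BoolPred k × List ℕ)) (o : List (Symbol k)) (v : Option (Symbol k)),
      (∀ C ∈ L, C.2.length = r + 1) →
      (popWhile .inp Option.isSome (blowClause k r)).Within
        (v, st (L.flatMap encPair) (digits k q) h [] [] o [] [])
        (none, st [] (digits k q) h [] []
          (((L.flatMap (copiesFirst q)).flatMap encPair).reverse ++ o) [] [])
        (62 * (L.flatMap encPair).length * (q + 1) ^ 2 + 2) := by
    intro L
    induction L with
    | nil =>
      intro o v _
      simpa using within_popWhile_stop (s := Stk.inp) (b := Option.isSome) (blowClause k r) v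
        (st [] (digits k q) h [] [] o [] []) rfl
    | cons C L ih =>
      rintro o v hL
      obtain ⟨p, us⟩ := C
      have hr := hL (p, us) (by simp)
      cases us with
      | nil => simp at hr
      | cons u us =>
        obtain rfl : us.length = r := by simpa using hr
        have h1 := within_blowClause q u p us h o (L.flatMap encPair)
        have := within_popWhile_step (s := Stk.inp) (b := Option.isSome) (v := v)
          (S := st (((p, u :: us) :: L).flatMap encPair) (digits k q) h [] [] o [] [])
          (B := 60 * (encPair (p, u :: us)).length * (q + 1) ^ 2) rfl
          (by simpa [encPair] using h1) (ih _ none fun C hC => hL C (by simp [hC]))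
        refine (this.mono ?_).of_eq (by simp)
        rw [List.flatMap_cons, List.length_append]
        have h1 : 1 ≤ (encPair (p, u :: us)).length := by simp [encPair]
        nlinarith [Nat.mul_le_mul h1 (Nat.one_le_pow 2 (q + 1) (by omega))]
  have hc : ∀ a : Symbol k, current (some a) = a := fun a => rfl
  have h1 := key L [] v hL
  have h2 := (within_pour (K := Stk) (s := .out) (d := .inp) (by decide) current _ none
    (st [] (digits k q) h [] []
      (((L.flatMap (copiesFirst q)).flatMap encPair).reverse ++ []) [] []) rfl).of_eq
    (S' := st ((L.flatMap (copiesFirst q)).flatMap encPair) (digits k q) h [] [] [] [] [])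
    (by simp [hc])
  refine (h1.seq h2).mono ?_
  have := length_flatMap_copiesFirst_le q L
  simp only [st_out, List.append_nil, List.length_reverse]
  nlinarith [Nat.one_le_pow 2 (q + 1) (by omega)]

/-- The size of an instance: its number of variables plus the length of the encoding of its
clauses. -/
def CSP.size (Φ : CSP k) : ℕ := Φ.numVars + (Φ.clauses.flatMap encClause).length

theorem exists_within_blowAll (k : ℕ) : ∃ P : Polynomial ℕ, ∀ (q : ℕ) (Φ : CSP k)
    (v : Option (Symbol k)), (∃ v', (blowAll k).Within
      (v, st (Φ.clauses.flatMap encClause) (digits k q) (digits k Φ.numVars) [] [] [] [] [])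
      (v', st ((blow q Φ).clauses.flatMap encClause) (digits k q) (digits k (blow q Φ).numVars)
        [] [] [] [] []) (P.eval (q + Φ.size))) ∧ (blow q Φ).size ≤ P.eval (q + Φ.size) := by
  obtain ⟨Q, hQ⟩ := exists_within_repeatN
    (X := List (Symbol k) × List (BoolPred k × List ℕ))
    (fun q x => st (x.2.flatMap encPair) (digits k q) x.1 [] [] [] [] [])
    (fun x => (x.2.flatMap encPair).length) (fun q x => (x.1, x.2.flatMap (copiesFirst q)))
    (blowFirst k (k - 1)) (fun x => ∀ C ∈ x.2, C.2.length = k - 1 + 1)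
    (fun q x hx C hC => by
      obtain ⟨D, hD, hCD⟩ := List.mem_flatMap.1 hC
      rw [length_of_mem_copiesFirst hCD, hx D hD])
    (80 * (Polynomial.X + 1) ^ 3)
    (fun q x v hx => by
      have h1 := within_blowFirst (k - 1) q x.1 x.2 hx v
      have h2 := length_flatMap_copiesFirst_le q x.2
      set l := (x.2.flatMap encPair).length
      have h3 : 80 * (l + 1) * (q + 1) ^ 2 ≤ 80 * (q + l + 1) ^ 3 := by
        calc 80 * (l + 1) * (q + 1) ^ 2 ≤ 80 * (q + l + 1) * (q + l + 1) ^ 2 := by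
              gcongr <;> omega
          _ = 80 * (q + l + 1) ^ 3 := by ring
      have h4 : 2 * (q + 1) ^ 2 * l ≤ 80 * (l + 1) * (q + 1) ^ 2 := by nlinarith
      simp only [Polynomial.eval_mul, Polynomial.eval_pow, Polynomial.eval_add, Polynomial.eval_X,
        Polynomial.eval_one, Polynomial.eval_ofNat]
      exact ⟨⟨none, h1.mono h3⟩, h2.trans (h4.trans h3)⟩) k
  have hiter : ∀ (q m : ℕ) (x : List (Symbol k) × List (BoolPred k × List ℕ)),
      (fun x : List (Symbol k) × List (BoolPred k × List ℕ) =>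
        (x.1, x.2.flatMap (copiesFirst q)))^[m] x =
      (x.1, (fun L => L.flatMap (copiesFirst q))^[m] x.2) := by
    intro q m
    induction m with
    | zero => intro x; rfl
    | succ m ih => intro x; rw [Function.iterate_succ_apply, Function.iterate_succ_apply, ih]
  have henc : ∀ {n : ℕ} (L : List (Clause k n)),
      (L.map Clause.toPair).flatMap encPair = L.flatMap encClause := by
    intro n L
    rw [List.flatMap_map]
    rfl
  refine ⟨10 * (Polynomial.X + 1) ^ 2 + Polynomial.X ^ 2 + (Polynomial.X + 1) + Q, fun q Φ v => ?_⟩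
  have h1 := within_mulNum v q Φ.numVars (Φ.clauses.flatMap encClause) [] [] []
  obtain ⟨⟨v', h2⟩, h3⟩ : (∃ v', (repeatN (blowFirst k (k - 1)) k).Within
      (none, st (Φ.clauses.flatMap encClause) (digits k q) (digits k (Φ.numVars * q))
        [] [] [] [] [])
      (v', st ((blow q Φ).clauses.flatMap encClause) (digits k q) (digits k (Φ.numVars * q))
        [] [] [] [] []) (Q.eval (q + (Φ.clauses.flatMap encClause).length) + 1)) ∧
      ((blow q Φ).clauses.flatMap encClause).length ≤
        Q.eval (q + (Φ.clauses.flatMap encClause).length) + Φ.size := by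
    -- For `k = 0` the invariant "length `k - 1 + 1`" fails for clauses, but then no pass is
    -- executed.
    rcases Nat.eq_zero_or_pos k with rfl | hk
    · have := iterate_copiesFirst_clauses q Φ
      rw [← henc, ← henc, ← this]
      refine ⟨⟨none, (within_load id none _).mono (by omega)⟩, ?_⟩
      rw [Function.iterate_zero_apply, henc]
      unfold CSP.size
      omega
    · have := hQ q (digits k (Φ.numVars * q), Φ.clauses.map Clause.toPair) none (by
        simp [Clause.toPair]; omega)
      simp only [hiter, iterate_copiesFirst_clauses, henc] at this
      exact ⟨this.1.imp fun v' h => h.mono (by omega), this.2.trans (by omega)⟩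
  have h4 : Q.eval (q + (Φ.clauses.flatMap encClause).length) ≤ Q.eval (q + Φ.size) :=
    eval_mono Q (by unfold CSP.size; omega)
  have h5 : Φ.numVars ≤ q + Φ.size := by unfold CSP.size; omega
  have h6 : q ≤ q + Φ.size := by omega
  have h7 := Nat.mul_le_mul h5 h6
  simp only [Polynomial.eval_mul, Polynomial.eval_pow, Polynomial.eval_add, Polynomial.eval_X,
    Polynomial.eval_one, Polynomial.eval_ofNat]
  refine ⟨⟨v', (h1.seq h2).mono ?_⟩, ?_⟩
  · nlinarith [Nat.mul_le_mul (Nat.succ_le_succ h5) (Nat.succ_le_succ h6)]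
  · change Φ.numVars * q + _ ≤ _
    nlinarith

/-- The factor is the length of the original encoding in all `c` rounds. It is read off once in
unary and kept on `fac`, so the total factor is a power of that length although only the length
itself is ever stored as a factor. -/
theorem polyTime_blow (k c : ℕ) : PolyTime (cspEncoding k) (cspEncoding k)
    fun Φ => (blow (encCSP Φ).length)^[c] Φ := by
  obtain ⟨P, hP⟩ := exists_within_blowAll k
  obtain ⟨Q, hQ⟩ := exists_within_repeatN
    (fun q (Φ : CSP k) => st (Φ.clauses.flatMap encClause) (digits k q) (digits k Φ.numVars)
      [] [] [] [] []) CSP.size blow (blowAll k) (fun _ => True) (fun _ _ _ => trivial) P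
    (fun q Φ v _ => hP q Φ v) c
  refine polyTime_of_within _ _ _ (blowProg k c) none .inp .inp
    (20 * (Polynomial.X + 1) + 4 * Q.comp (2 * Polynomial.X)) fun Φ => ?_
  have hc : ∀ a : Symbol k, current (some a) = a := fun a => rfl
  set ℓ := (encCSP Φ).length with hℓ
  set Ψ := (blow ℓ)^[c] Φ with hΨ
  have hinit : ∀ l : List (Symbol k),
      Function.update (fun _ => []) Stk.inp l = st l [] [] [] [] [] [] [] := by
    intro l; funext s; cases s <;> rfl
  have hsize : Φ.size ≤ ℓ := by
    simp only [hℓ, encCSP, CSP.size, List.length_append, length_encUnary]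
    omega
  have h1 := (within_pourTwo (K := Stk) (s := .inp) (d := .out) (e := .fac) (by decide) (by decide)
    (by decide) current (fun _ => digit k) _ none (st (encCSP Φ) [] [] [] [] [] [] []) rfl).of_eq
    (S' := st [] (digits k ℓ) [] [] [] (encCSP Φ).reverse [] []) (by simp [hc, hℓ])
  have h2 := (within_pour (K := Stk) (s := .out) (d := .inp) (by decide) current _ none
    (st [] (digits k ℓ) [] [] [] (encCSP Φ).reverse [] []) rfl).of_eq
    (S' := st (encCSP Φ) (digits k ℓ) [] [] [] [] [] []) (by simp [hc])
  have h3 := (within_readDigits .num (by decide) (Φ.clauses.flatMap encClause) Φ.numVars none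
    (st (encCSP Φ) (digits k ℓ) [] [] [] [] [] []) rfl).of_eq
    (S' := st (Φ.clauses.flatMap encClause) (digits k ℓ) (digits k Φ.numVars) [] [] [] [] [])
    (by simp)
  obtain ⟨⟨v, h4⟩, h5⟩ := hQ ℓ Φ (some (marker k)) trivial
  have h6 := (within_push Stk.inp (fun _ => marker k) v (st (Ψ.clauses.flatMap encClause)
    (digits k ℓ) (digits k Ψ.numVars) [] [] [] [] [])).of_eq
    (S' := st (marker k :: Ψ.clauses.flatMap encClause)
    (digits k ℓ) (digits k Ψ.numVars) [] [] [] [] []) (by simp)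
  have h7 := (within_pour (K := Stk) (s := .num) (d := .inp) (by decide) (fun _ => digit k) _ v
    (st (marker k :: Ψ.clauses.flatMap encClause)
    (digits k ℓ) (digits k Ψ.numVars) [] [] [] [] []) rfl).of_eq
    (S' := st (encCSP Ψ) (digits k ℓ) [] [] [] [] [] []) (by simp [encCSP, encUnary])
  have h8 := (within_clear (K := Stk) .fac _ none
    (st (encCSP Ψ) (digits k ℓ) [] [] [] [] [] []) rfl).of_eq
    (S' := st (encCSP Ψ) [] [] [] [] [] [] []) (by simp)
  rw [hinit, hinit]
  refine ((h1.seq (h2.seq h3)).seq (h4.seq (h6.seq (h7.seq h8)))).mono ?_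
  rw [← hΨ] at h5
  have h9 : Q.eval (ℓ + Φ.size) ≤ Q.eval (2 * ℓ) := eval_mono Q (by omega)
  have h10 : Ψ.numVars ≤ Ψ.size := by unfold CSP.size; omega
  have h11 : Φ.numVars ≤ Φ.size := by unfold CSP.size; omega
  change _ ≤ Polynomial.eval ℓ _
  simp only [Polynomial.eval_mul, Polynomial.eval_add, Polynomial.eval_X, Polynomial.eval_comp,
    Polynomial.eval_one, Polynomial.eval_ofNat, st_inp, st_out, st_num, st_fac,
    List.length_reverse, List.length_replicate]
  omega

/-! ### The value of a blow-up -/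

theorem mem_allTuples (N : ℕ) : ∀ {k : ℕ} (j : Fin k → Fin N), j ∈ allTuples N k
  | 0, j => by simp [allTuples, Subsingleton.elim j Fin.elim0]
  | k + 1, j => by
    rw [allTuples, List.mem_flatMap]
    exact ⟨j 0, List.mem_finRange _, List.mem_map.2 ⟨Fin.tail j, mem_allTuples N _,
      Fin.cons_self_tail j⟩⟩

theorem nodup_allTuples (N : ℕ) : ∀ k : ℕ, (allTuples N k).Nodup
  | 0 => by simp [allTuples]
  | k + 1 => by
    rw [allTuples, List.nodup_flatMap]
    refine ⟨fun a _ => (nodup_allTuples N k).map (Fin.cons_right_injective (α := fun _ => Fin N) a), ?_⟩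
    refine (List.nodup_finRange N).imp fun {a b} hab => ?_
    rw [Function.onFun, List.disjoint_left]
    intro x hx hx'
    obtain ⟨y, -, rfl⟩ := List.mem_map.1 hx
    obtain ⟨z, -, h⟩ := List.mem_map.1 hx'
    exact hab (by simpa using (congrFun h 0).symm)

theorem perm_allTuples (N k : ℕ) :
    (allTuples N k).Perm (Finset.univ : Finset (Fin k → Fin N)).toList :=
  (List.perm_ext_iff_of_nodup (nodup_allTuples N k) (Finset.nodup_toList _)).2 fun j => by
    simp [mem_allTuples]

theorem length_allTuples (N k : ℕ) : (allTuples N k).length = N ^ k := by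
  simp [(perm_allTuples N k).length_eq]

theorem countP_allTuples (N k : ℕ) (f : (Fin k → Fin N) → Bool) :
    (allTuples N k).countP f = ∑ j : Fin k → Fin N, (f j).toNat := by
  have h : ∀ l : List (Fin k → Fin N), l.countP f = (l.map fun j => (f j).toNat).sum := by
    intro l
    induction l with
    | nil => rfl
    | cons a l ih => cases hf : f a <;> simp [hf, ih, add_comm]
  rw [h, ((perm_allTuples N k).map _).sum_eq]
  simp

/-- Averages over the coordinates selected by an injection are averages over all tuples. -/
theorem sum_comp_embedding {n N : ℕ} (e : Fin k ↪ Fin n) (g : (Fin k → Fin N) → ℕ) :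
    N ^ k * ∑ J : Fin n → Fin N, g (fun l => J (e l)) = N ^ n * ∑ j, g j := by
  classical
  have key : ∃ R : ℕ, ∀ g : (Fin k → Fin N) → ℕ,
      ∑ J : Fin n → Fin N, g (fun l => J (e l)) = R * ∑ j, g j := by
    -- Values off the range of `e` are free, so all fibres of the restriction map have the same
    -- size.
    refine ⟨Fintype.card ({a // ¬ a ∈ Set.range e} → Fin N), fun g => ?_⟩
    have h1 : ∑ J : Fin n → Fin N, g (fun l => J (e l)) =
        ∑ x : ({a // a ∈ Set.range e} → Fin N) × ({a // ¬ a ∈ Set.range e} → Fin N),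
          g (fun l => x.1 ⟨e l, l, rfl⟩) :=
      Fintype.sum_equiv (Equiv.piEquivPiSubtypeProd (· ∈ Set.range e) fun _ => Fin N) _ _
        fun J => rfl
    have h2 : ∑ a : {a // a ∈ Set.range e} → Fin N, g (fun l => a ⟨e l, l, rfl⟩) = ∑ j, g j :=
      Fintype.sum_equiv ((Equiv.ofInjective e e.injective).symm.arrowCongr (Equiv.refl _)) _ _
        fun a => rfl
    rw [h1, Fintype.sum_prod_type, ← h2, Finset.mul_sum]
    simp
  obtain ⟨R, hR⟩ := key
  -- The constant function determines the fibre size through `N ^ n = R * N ^ k`, avoiding a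
  -- subtraction of exponents.
  have h1 := hR fun _ => 1
  simp only [Finset.sum_const, Finset.card_univ, Fintype.card_pi, Fintype.card_fin,
    Finset.prod_const, smul_eq_mul, mul_one] at h1
  rw [hR, h1]
  ring

theorem numVars_blow (N : ℕ) (Φ : CSP k) : (blow N Φ).numVars = Φ.numVars * N := rfl

theorem length_clauses_blow (N : ℕ) (Φ : CSP k) :
    (blow N Φ).clauses.length = Φ.clauses.length * N ^ k := by
  simp [blow, List.length_flatMap, length_allTuples]

theorem isOver_blow {F : Set (BoolPred k)} {N : ℕ} {Φ : CSP k} (h : Φ.IsOver F) :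
    (blow N Φ).IsOver F := by
  intro C hC
  obtain ⟨D, hD, hC⟩ := List.mem_flatMap.1 hC
  obtain ⟨j, -, rfl⟩ := List.mem_map.1 hC
  exact h D hD

theorem Clause.copy_inj {n N : ℕ} {C D : Clause k n} {i j : Fin k → Fin N}
    (h : C.copy i = D.copy j) : C = D ∧ i = j := by
  have hv : ∀ l, (C.vars l, i l) = (D.vars l, j l) := fun l =>
    finProdFinEquiv.injective (DFunLike.congr_fun (congrArg Clause.vars h) l)
  refine ⟨Clause.ext
    (show (C.copy i).pred = (D.copy j).pred from congrArg _ h) ?_, funext fun l => congrArg Prod.snd (hv l)⟩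
  exact DFunLike.ext _ _ fun l => congrArg Prod.fst (hv l)

theorem isSimple_blow {N : ℕ} {Φ : CSP k} (h : Φ.IsSimple) : (blow N Φ).IsSimple := by
  refine List.nodup_flatMap.2 ⟨fun C _ => (nodup_allTuples N k).map
    fun i j hij => (Clause.copy_inj hij).2, h.imp fun {C D} hCD => ?_⟩
  intro x hx hx'
  obtain ⟨i, -, rfl⟩ := List.mem_map.1 hx
  obtain ⟨j, -, h⟩ := List.mem_map.1 hx'
  exact hCD (Clause.copy_inj h).1.symm

/-- The assignment of an instance induced by an assignment of its blow-up and a choice of one copy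
of each variable. -/
def selectCopies {n N : ℕ} (τ : Fin (n * N) → Bool) (J : Fin n → Fin N) : Fin n → Bool :=
  fun v => τ (finProdFinEquiv (v, J v))

theorem isSat_copy {n N : ℕ} (C : Clause k n) (τ : Fin (n * N) → Bool) (J : Fin n → Fin N) :
    (C.copy fun l => J (C.vars l)).IsSat τ = C.IsSat (selectCopies τ J) := rfl

/-- Double counting: by injectivity of `C.vars`, each copy of a clause `C` is selected by equally
many `J`. Clearing denominators keeps the averaging identity in `ℕ`. -/
theorem sum_countP_selectCopies {n N : ℕ} (τ : Fin (n * N) → Bool) (L : List (Clause k n)) :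
    N ^ k * ∑ J : Fin n → Fin N, L.countP (fun C => C.IsSat (selectCopies τ J)) =
      N ^ n * (L.flatMap fun C => (allTuples N k).map C.copy).countP fun C => C.IsSat τ := by
  induction L with
  | nil => simp
  | cons C L ih =>
    have h := sum_comp_embedding C.vars fun j => ((C.copy j).IsSat τ).toNat
    have h1 : ∀ J : Fin n → Fin N, (C :: L).countP (fun C => C.IsSat (selectCopies τ J)) =
        ((C.copy fun l => J (C.vars l)).IsSat τ).toNat +
          L.countP (fun C => C.IsSat (selectCopies τ J)) := by
      intro J
      rw [isSat_copy]
      cases hs : C.IsSat (selectCopies τ J) <;> simp [hs, add_comm]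
    rw [Finset.sum_congr rfl fun J _ => h1 J, Finset.sum_add_distrib, mul_add, h, ih,
      List.flatMap_cons, List.countP_append, mul_add, List.countP_map, countP_allTuples]
    rfl

/-- Some choice of copies does at least as well as the average over all choices. -/
theorem exists_countP_blow_le {N : ℕ} (hN : 0 < N) (Φ : CSP k)
    (τ : Fin (blow N Φ).numVars → Bool) : ∃ σ : Fin Φ.numVars → Bool,
      ((blow N Φ).clauses.countP fun C => C.IsSat τ) ≤
        (Φ.clauses.countP fun C => C.IsSat σ) * N ^ k := by
  by_contra! hcon
  have h := sum_countP_selectCopies (k := k) (n := Φ.numVars) (N := N) τ Φ.clauses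
  have : Nonempty (Fin N) := ⟨⟨0, hN⟩⟩
  have hlt : ∑ J : Fin Φ.numVars → Fin N,
      (Φ.clauses.countP fun C => C.IsSat (selectCopies τ J)) * N ^ k <
      ∑ J : Fin Φ.numVars → Fin N, (blow N Φ).clauses.countP fun C => C.IsSat τ :=
    Finset.sum_lt_sum_of_nonempty Finset.univ_nonempty fun J _ => hcon (selectCopies τ J)
  rw [← Finset.sum_mul, mul_comm, h] at hlt
  simp [blow] at hlt

theorem countP_blow (N : ℕ) (Φ : CSP k) (σ : Fin Φ.numVars → Bool) :
    ((blow N Φ).clauses.countP fun C => C.IsSat fun v : Fin (Φ.numVars * N) =>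
      σ (finProdFinEquiv.symm v).1) = (Φ.clauses.countP fun C => C.IsSat σ) * N ^ k := by
  obtain ⟨n, L⟩ := Φ
  simp only [blow]
  have h : ∀ (C : Clause k n) (j : Fin k → Fin N),
      (C.copy j).IsSat (fun v => σ (finProdFinEquiv.symm v).1) = C.IsSat σ := by
    intro C j
    change C.pred (fun l => σ (finProdFinEquiv.symm (finProdFinEquiv (C.vars l, j l))).1) = _
    simp only [Equiv.symm_apply_apply]
    rfl
  induction L with
  | nil => simp
  | cons C L ih =>
    rw [List.flatMap_cons, List.countP_append, ih σ h, List.countP_map, List.countP_cons, add_mul,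
      add_comm]
    congr 1
    have h' : ((fun C : Clause k (n * N) => C.IsSat fun v => σ (finProdFinEquiv.symm v).1) ∘
        C.copy) = fun _ => C.IsSat σ := funext fun j => h C j
    rw [h']
    cases C.IsSat σ <;> simp [length_allTuples]

namespace CSP

theorem valAt_of_ne_nil {Φ : CSP k} (h : Φ.clauses ≠ []) (σ : Fin Φ.numVars → Bool) :
    Φ.valAt σ = (Φ.clauses.countP fun C => C.IsSat σ : ℝ) / (Φ.clauses.length : ℝ) := by
  rw [valAt, if_neg (by simpa using h)]

theorem val_of_eq_nil {Φ : CSP k} (h : Φ.clauses = []) : Φ.val = 1 := by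
  have : Φ.valAt = fun _ => 1 := funext fun σ => by simp [valAt, h]
  rw [val, this, Finset.sup'_const]

theorem le_val_iff {Φ : CSP k} (h : Φ.clauses ≠ []) {c : ℝ} :
    c ≤ Φ.val ↔ ∃ σ : Fin Φ.numVars → Bool,
      c * Φ.clauses.length ≤ (Φ.clauses.countP fun C => C.IsSat σ : ℝ) := by
  have hpos : (0 : ℝ) < Φ.clauses.length := by exact_mod_cast List.length_pos_iff.2 h
  simp [val, Finset.le_sup'_iff, valAt_of_ne_nil h, le_div_iff₀ hpos]

theorem val_le_iff {Φ : CSP k} (h : Φ.clauses ≠ []) {s : ℝ} :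
    Φ.val ≤ s ↔ ∀ σ : Fin Φ.numVars → Bool,
      (Φ.clauses.countP fun C => C.IsSat σ : ℝ) ≤ s * Φ.clauses.length := by
  have hpos : (0 : ℝ) < Φ.clauses.length := by exact_mod_cast List.length_pos_iff.2 h
  simp [val, valAt_of_ne_nil h, div_le_iff₀ hpos]

end CSP

theorem val_blow {N : ℕ} (hN : 0 < N) (Φ : CSP k) : (blow N Φ).val = Φ.val := by
  have hlen := length_clauses_blow N Φ
  have hNk : 0 < N ^ k := pow_pos hN k
  by_cases h : Φ.clauses = []
  · rw [CSP.val_of_eq_nil h, CSP.val_of_eq_nil]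
    rw [← List.length_eq_zero_iff, hlen, h]
    simp
  have h' : (blow N Φ).clauses ≠ [] := by
    rw [← List.length_pos_iff, hlen]
    exact Nat.mul_pos (List.length_pos_iff.2 h) hNk
  refine le_antisymm ((CSP.val_le_iff h').2 fun τ => ?_) ((CSP.le_val_iff h').2 ?_)
  · obtain ⟨σ, hσ⟩ := exists_countP_blow_le hN Φ τ
    have h1 := (CSP.val_le_iff h).1 le_rfl σ
    calc ((blow N Φ).clauses.countP fun C => C.IsSat τ : ℝ)
        ≤ (Φ.clauses.countP fun C => C.IsSat σ : ℝ) * (N : ℝ) ^ k := by exact_mod_cast hσ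
      _ ≤ Φ.val * Φ.clauses.length * (N : ℝ) ^ k := by gcongr
      _ = Φ.val * (blow N Φ).clauses.length := by rw [hlen]; push_cast; ring
  · obtain ⟨σ, hσ⟩ := (CSP.le_val_iff h).1 le_rfl
    refine ⟨fun v : Fin (Φ.numVars * N) => σ (finProdFinEquiv.symm v).1, ?_⟩
    rw [countP_blow, hlen]
    push_cast
    rw [← mul_assoc]
    gcongr

theorem iterate_blow (N : ℕ) (hN : 0 < N) (Φ : CSP k) : ∀ c : ℕ,
    ((blow N)^[c] Φ).numVars = Φ.numVars * N ^ c ∧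
    ((blow N)^[c] Φ).clauses.length = Φ.clauses.length * (N ^ c) ^ k ∧
    ((blow N)^[c] Φ).val = Φ.val ∧
    (∀ F, Φ.IsOver F → ((blow N)^[c] Φ).IsOver F)
  | 0 => by simp
  | c + 1 => by
    obtain ⟨h1, h2, h3, h4⟩ := iterate_blow N hN Φ c
    rw [Function.iterate_succ_apply']
    refine ⟨?_, ?_, ?_, fun F hF => isOver_blow (h4 F hF)⟩
    · rw [numVars_blow, h1, pow_succ, mul_assoc]
    · rw [length_clauses_blow, h2, pow_succ, mul_pow, mul_assoc]
    · rw [val_blow hN, h3]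

/-! ### Concentration of percolated lists -/

section Percolation

variable {γ : Type}

theorem toOuterMeasure_keepEach_cons (p : unitInterval) (C : γ) (L : List γ) (s : Set (List γ)) :
    (keepEach p (C :: L)).toOuterMeasure s =
      ENNReal.ofReal p * (keepEach p L).toOuterMeasure {L' | C :: L' ∈ s} +
        ENNReal.ofReal (1 - p) * (keepEach p L).toOuterMeasure s := by
  rw [keepEach, PMF.toOuterMeasure_bind_apply, tsum_bool, add_comm, PMF.toOuterMeasure_map_apply,
    PMF.toOuterMeasure_map_apply]
  simp [coin, Set.preimage]

theorem sublist_of_mem_support_keepEach (p : unitInterval) : ∀ (L : List γ) {L' : List γ},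
    L' ∈ (keepEach p L).support → L'.Sublist L
  | [], L', h => by
    have : L' = [] := by simpa [keepEach] using h
    rw [this]
  | C :: L, L', h => by
    rw [keepEach, PMF.mem_support_bind_iff] at h
    obtain ⟨b, -, h⟩ := h
    rw [PMF.mem_support_map_iff] at h
    obtain ⟨L'', h, rfl⟩ := h
    have ih := sublist_of_mem_support_keepEach p L h
    cases b
    · exact ih.trans (List.sublist_cons_self C L)
    · exact ih.cons_cons C

/-- Chernoff's exponential moment bound, proved by conditioning on the first entry. The offset `x`
carries the weight of the entries already kept. -/
theorem toOuterMeasure_keepEach_sum_nonneg_le (p : unitInterval) (w : γ → ℝ) (hw : ∀ C, |w C| ≤ 1)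
    {t : ℝ} (ht : 0 ≤ t) (ht1 : t ≤ 1) : ∀ (L : List γ) (x : ℝ),
    (keepEach p L).toOuterMeasure {L' | 0 ≤ x + (L'.map w).sum} ≤
      ENNReal.ofReal (Real.exp (t * x + p * (t * (L.map w).sum + t ^ 2 * L.length)))
  | [], x => by
    rw [keepEach, PMF.toOuterMeasure_pure_apply]
    split_ifs with h
    · have hx : 0 ≤ x := by simpa using h
      rw [← ENNReal.ofReal_one]
      refine ENNReal.ofReal_le_ofReal (Real.one_le_exp ?_)
      simpa using mul_nonneg ht hx
    · exact zero_le
  | C :: L, x => by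
    have h1 := toOuterMeasure_keepEach_sum_nonneg_le p w hw ht ht1 L (x + w C)
    have h2 := toOuterMeasure_keepEach_sum_nonneg_le p w hw ht ht1 L x
    have hp0 : (0 : ℝ) ≤ p := p.2.1
    have hp1 : (0 : ℝ) ≤ 1 - p := sub_nonneg.2 p.2.2
    rw [toOuterMeasure_keepEach_cons]
    have hset : {L' : List γ | C :: L' ∈ {L' : List γ | 0 ≤ x + (L'.map w).sum}} =
        {L' | 0 ≤ (x + w C) + (L'.map w).sum} := by
      ext L'
      simp [add_assoc]
    rw [hset]
    refine (add_le_add (mul_le_mul_right h1 _) (mul_le_mul_right h2 _)).trans ?_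
    rw [← ENNReal.ofReal_mul hp0, ← ENNReal.ofReal_mul hp1,
      ← ENNReal.ofReal_add (by positivity) (by positivity)]
    refine ENNReal.ofReal_le_ofReal ?_
    set A := (p : ℝ) * (t * (L.map w).sum + t ^ 2 * L.length)
    have hB : t * x + p * (t * ((C :: L).map w).sum + t ^ 2 * (C :: L).length) =
        (t * x + A) + p * (t * w C + t ^ 2) := by
      simp only [A, List.map_cons, List.sum_cons, List.length_cons]
      push_cast
      ring
    rw [hB, Real.exp_add (t * x + A), show t * (x + w C) + A = (t * x + A) + t * w C by ring,
      Real.exp_add (t * x + A)]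
    have habs : |t * w C| ≤ 1 := by
      rw [abs_mul, abs_of_nonneg ht]
      exact mul_le_one₀ ht1 (abs_nonneg _) (hw C)
    -- From `exp y ≤ 1 + y + y ^ 2` for `|y| ≤ 1`, the factor contributed by one entry is at most `1
    -- + p * (t * w C + t ^ 2)`, hence at most the exponential of the added term.
    have h3 := (abs_le.1 (Real.abs_exp_sub_one_sub_id_le habs)).2
    have h4 : (t * w C) ^ 2 ≤ t ^ 2 := by
      rw [mul_pow]
      exact mul_le_of_le_one_right (sq_nonneg t) ((sq_le_one_iff_abs_le_one _).2 (hw C))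
    have h5 : p * Real.exp (t * w C) + (1 - p) ≤ Real.exp (p * (t * w C + t ^ 2)) := by
      have h6 := Real.add_one_le_exp ((p : ℝ) * (t * w C + t ^ 2))
      nlinarith
    have h7 := mul_le_mul_of_nonneg_left h5 (Real.exp_pos (t * x + A)).le
    nlinarith

/-- If for finitely many weights with values in `[-1, 1]` the average weight of the list is at most
`-ε`, then with high probability the percolated list has negative weights. -/
theorem le_toReal_toOuterMeasure_keepEach (p : unitInterval) (L : List γ) (G : Set (List γ))
    {ι : Type} [Fintype ι] (w : ι → γ → ℝ) (hw : ∀ i C, |w i C| ≤ 1) {ε : ℝ} (hε : 0 ≤ ε)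
    (hε2 : ε ≤ 2) (hsum : ∀ i, (L.map (w i)).sum ≤ -ε * L.length)
    (hG : ∀ L' : List γ, L'.Sublist L → (∀ i, (L'.map (w i)).sum < 0) → L' ∈ G) :
    1 - Fintype.card ι * Real.exp (-(p * L.length * (ε ^ 2 / 4))) ≤
      ((keepEach p L).toOuterMeasure G).toReal := by
  set μ := (keepEach p L).toOuterMeasure
  have huniv : μ Set.univ = 1 :=
    (PMF.toOuterMeasure_apply_eq_one_iff _ _).2 (Set.subset_univ _)
  have htop : ∀ s, μ s ≠ ⊤ := fun s =>
    (((MeasureTheory.measure_mono (Set.subset_univ s)).trans_eq huniv).trans_lt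
      ENNReal.one_lt_top).ne
  have hsup : μ (keepEach p L).supportᶜ = 0 :=
    (PMF.toOuterMeasure_apply_eq_zero_iff _ _).2 disjoint_compl_right
  have hbad : ∀ i, μ {L' | 0 ≤ (L'.map (w i)).sum} ≤
      ENNReal.ofReal (Real.exp (-(p * L.length * (ε ^ 2 / 4)))) := by
    intro i
    -- The choice `t = ε / 2` minimises `-t * ε + t ^ 2`, with value `-ε ^ 2 / 4`; the bound `ε ≤ 2`
    -- ensures `t ≤ 1`.
    have h := toOuterMeasure_keepEach_sum_nonneg_le p (w i) (hw i) (t := ε / 2) (by linarith)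
      (by linarith) L 0
    simp only [zero_add, mul_zero] at h
    refine h.trans (ENNReal.ofReal_le_ofReal (Real.exp_le_exp.2 ?_))
    have h1 := mul_le_mul_of_nonneg_left (hsum i) (by linarith : 0 ≤ ε / 2)
    have h2 := mul_le_mul_of_nonneg_left h1 p.2.1
    nlinarith
  -- Only sublists of `L` are known to land in `G`, so the null set outside the support is split
  -- off.
  have hcover : (Set.univ : Set (List γ)) ⊆
      G ∪ ((keepEach p L).supportᶜ ∪ ⋃ i, {L' | 0 ≤ (L'.map (w i)).sum}) := by
    intro L' _
    by_cases hs : L' ∈ (keepEach p L).support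
    · by_cases hb : ∀ i, (L'.map (w i)).sum < 0
      · exact Or.inl (hG L' (sublist_of_mem_support_keepEach p L hs) hb)
      · push Not at hb
        exact Or.inr (Or.inr (Set.mem_iUnion.2 hb))
    · exact Or.inr (Or.inl hs)
  have h1 : (1 : ENNReal) ≤ μ G +
      Fintype.card ι * ENNReal.ofReal (Real.exp (-(p * L.length * (ε ^ 2 / 4)))) := by
    rw [← huniv]
    refine (MeasureTheory.measure_mono hcover).trans ((MeasureTheory.measure_union_le _ _).trans ?_)
    gcongr
    refine (MeasureTheory.measure_union_le _ _).trans ?_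
    rw [hsup, zero_add]
    refine (MeasureTheory.measure_iUnion_fintype_le _ _).trans
      ((Finset.sum_le_sum fun i _ => hbad i).trans ?_)
    simp
  have h2 := ENNReal.toReal_mono (ENNReal.add_ne_top.2 ⟨htop G,
    ENNReal.mul_ne_top (ENNReal.natCast_ne_top _) ENNReal.ofReal_ne_top⟩) h1
  rw [ENNReal.toReal_add (htop G) (ENNReal.mul_ne_top (ENNReal.natCast_ne_top _)
    ENNReal.ofReal_ne_top), ENNReal.toReal_mul, ENNReal.toReal_ofReal (Real.exp_pos _).le] at h2
  simp only [ENNReal.toReal_one, ENNReal.toReal_natCast] at h2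
  linarith

end Percolation

/-! ### From weights of percolated lists to values of percolated instances -/

theorem sum_map_ite_sub {γ : Type} (f : γ → Bool) (a : ℝ) (L : List γ) :
    (L.map fun C => (if f C then 1 else 0) - a).sum = (L.countP f : ℝ) - a * L.length := by
  induction L with
  | nil => simp
  | cons C L ih =>
    rw [List.map_cons, List.sum_cons, ih, List.countP_cons, List.length_cons]
    split_ifs <;> push_cast <;> ring

theorem isOver_sublist {F : Set (BoolPred k)} {n : ℕ} {L L' : List (Clause k n)}
    (h : CSP.IsOver F ⟨n, L⟩) (hL : L'.Sublist L) : CSP.IsOver F ⟨n, L'⟩ :=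
  fun C hC => h C (hL.subset hC)

theorem isSimple_sublist {n : ℕ} {L L' : List (Clause k n)}
    (h : CSP.IsSimple ⟨n, L⟩) (hL : L'.Sublist L) : CSP.IsSimple ⟨n, L'⟩ :=
  List.Nodup.sublist hL h

/-- Percolating an instance of large value yields an instance of large value. -/
theorem le_toReal_clausePerc_of_le_val (p : ℕ → unitInterval) (Φ : CSP k) (S : Set (CSP k))
    {c ε : ℝ} (hε : 0 ≤ ε) (hcε : 0 ≤ c - ε) (hc : c ≤ 1) (hval : c ≤ Φ.val)
    (hS : ∀ L' : List (Clause k Φ.numVars), L'.Sublist Φ.clauses →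
      c - ε ≤ CSP.val ⟨Φ.numVars, L'⟩ → (⟨Φ.numVars, L'⟩ : CSP k) ∈ S)
    (hne : Φ.clauses ≠ []) :
    1 - (2 : ℝ) ^ Φ.numVars * Real.exp (-(p Φ.numVars * Φ.clauses.length * (ε ^ 2 / 4))) ≤
      ((clausePerc p Φ).toOuterMeasure S).toReal := by
  obtain ⟨σ, hσ⟩ := (CSP.le_val_iff hne).1 hval
  rw [clausePerc, PMF.toOuterMeasure_map_apply]
  have hsum : ∀ L : List (Clause k Φ.numVars),
      (L.map fun C => (c - ε) - if C.IsSat σ then 1 else 0).sum =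
        (c - ε) * L.length - (L.countP fun C => C.IsSat σ : ℝ) := by
    intro L
    induction L with
    | nil => simp
    | cons C L ih =>
      rw [List.map_cons, List.sum_cons, ih, List.countP_cons, List.length_cons]
      split_ifs <;> push_cast <;> ring
  have h := le_toReal_toOuterMeasure_keepEach (p Φ.numVars) Φ.clauses
    ((fun L => (⟨Φ.numVars, L⟩ : CSP k)) ⁻¹' S) (ι := Unit)
    (fun _ C => (c - ε) - if C.IsSat σ then 1 else 0)
    (fun _ C => by split_ifs <;> rw [abs_le] <;> constructor <;> linarith) hε (by linarith)
    (fun _ => by rw [hsum]; linarith)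
    (fun L' hL' h => hS L' hL' (by
      have h0 := h ()
      rw [hsum] at h0
      -- The empty list has weight zero, so strict negativity excludes it.
      have hne' : L' ≠ [] := by
        rintro rfl
        simp at h0
      exact (CSP.le_val_iff (Φ := ⟨Φ.numVars, L'⟩) hne').2 ⟨σ, by
        change (c - ε) * (L'.length : ℝ) ≤ _
        linarith⟩))
  refine le_trans ?_ h
  -- One optimal assignment suffices here; the factor `2 ^ Φ.numVars` is slack that gives the same
  -- bound as in the case of small value.
  have h2 : (1 : ℝ) ≤ 2 ^ Φ.numVars := one_le_pow₀ one_le_two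
  have h3 := Real.exp_pos (-(p Φ.numVars * Φ.clauses.length * (ε ^ 2 / 4)))
  rw [Fintype.card_unit, Nat.cast_one]
  gcongr

/-- Percolating an instance of small value yields an instance of small value. -/
theorem le_toReal_clausePerc_of_val_le (p : ℕ → unitInterval) (Φ : CSP k) (S : Set (CSP k))
    {s ε : ℝ} (hε : 0 ≤ ε) (hs : 0 ≤ s) (hsε : s + ε ≤ 1) (hval : Φ.val ≤ s)
    (hS : ∀ L' : List (Clause k Φ.numVars), L'.Sublist Φ.clauses →
      CSP.val ⟨Φ.numVars, L'⟩ ≤ s + ε → (⟨Φ.numVars, L'⟩ : CSP k) ∈ S)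
    (hne : Φ.clauses ≠ []) :
    1 - (2 : ℝ) ^ Φ.numVars * Real.exp (-(p Φ.numVars * Φ.clauses.length * (ε ^ 2 / 4))) ≤
      ((clausePerc p Φ).toOuterMeasure S).toReal := by
  have hσ := (CSP.val_le_iff hne).1 hval
  rw [clausePerc, PMF.toOuterMeasure_map_apply]
  have h := le_toReal_toOuterMeasure_keepEach (p Φ.numVars) Φ.clauses
    ((fun L => (⟨Φ.numVars, L⟩ : CSP k)) ⁻¹' S) (ι := Fin Φ.numVars → Bool)
    (fun σ C => (if C.IsSat σ then 1 else 0) - (s + ε))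
    (fun _ C => by split_ifs <;> rw [abs_le] <;> constructor <;> linarith) hε (by linarith)
    (fun σ => by
      have := hσ σ
      rw [sum_map_ite_sub]
      linarith)
    (fun L' hL' h => hS L' hL' (by
      -- Losing all clauses would raise the value to `1`; strict negativity for any single
      -- assignment rules this out.
      have hne' : L' ≠ [] := by
        rintro rfl
        simpa using h fun _ => true
      refine (CSP.val_le_iff (Φ := ⟨Φ.numVars, L'⟩) hne').2 fun σ => ?_
      have h0 := h σ
      rw [sum_map_ite_sub] at h0
      change _ ≤ (s + ε) * (L'.length : ℝ)
      linarith))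
  simpa using h

theorem toReal_clausePerc_of_eq_nil (p : ℕ → unitInterval) {Φ : CSP k} {S : Set (CSP k)}
    (hΦ : Φ.clauses = []) (hS : Φ ∈ S) : ((clausePerc p Φ).toOuterMeasure S).toReal = 1 := by
  obtain ⟨n, L⟩ := Φ
  obtain rfl : L = [] := hΦ
  rw [clausePerc, keepEach, PMF.pure_map, PMF.toOuterMeasure_pure_apply, if_pos hS,
    ENNReal.toReal_one]

/-! ### Robustness of the blow-up reduction -/

/-- With `b = ℓ ^ c`, the threshold equals `n * b * (n * b) ^ (δ - k)`, so multiplying by `b ^ k`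
leaves `n * b * n ^ (δ - k) * b ^ δ`. Of the gain `b ^ δ ≥ ℓ ^ (k + 1)`, a factor `ℓ ^ k` pays for
`n ^ (δ - k)` and one factor `ℓ` remains. -/
theorem mul_le_of_threshold_lt {k n ℓ c m : ℕ} {δ p : ℝ} (hn : 1 ≤ n) (hnℓ : n ≤ ℓ) (hδ : 0 < δ)
    (hc : (k : ℝ) + 1 ≤ δ * c) (hm : 1 ≤ m)
    (hp : 1 / ((n * ℓ ^ c : ℕ) : ℝ) ^ ((k : ℝ) - 1 - δ) < p) :
    ((n * ℓ ^ c : ℕ) : ℝ) * ℓ ≤ p * (m * (ℓ ^ c) ^ k : ℕ) := by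
  have ha : (1 : ℝ) ≤ n := by exact_mod_cast hn
  have hl : (1 : ℝ) ≤ ℓ := by exact_mod_cast hn.trans hnℓ
  have hal : (n : ℝ) ≤ ℓ := by exact_mod_cast hnℓ
  have ha0 : (0 : ℝ) < n := by linarith
  have hl0 : (0 : ℝ) < ℓ := by linarith
  have hm1 : (1 : ℝ) ≤ m := by exact_mod_cast hm
  have hb0 : (0 : ℝ) < (ℓ : ℝ) ^ c := by positivity
  push_cast at hp ⊢
  set b : ℝ := (ℓ : ℝ) ^ c with hb
  have hx0 : 0 < (n : ℝ) * b := by positivity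
  have h1 : 1 / ((n : ℝ) * b) ^ ((k : ℝ) - 1 - δ) =
      n * b * ((n : ℝ) ^ (δ - k) * b ^ (δ - k)) := by
    rw [one_div, ← Real.rpow_neg hx0.le, show -((k : ℝ) - 1 - δ) = 1 + (δ - k) by ring,
      Real.rpow_add hx0, Real.rpow_one, Real.mul_rpow ha0.le hb0.le]
  have h2 : b ^ (δ - k) * b ^ k = b ^ δ := by
    rw [← Real.rpow_natCast b k, ← Real.rpow_add hb0, sub_add_cancel]
  have h3 : (ℓ : ℝ) ^ ((k : ℝ) + 1) ≤ b ^ δ := by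
    rw [hb, ← Real.rpow_natCast, ← Real.rpow_mul hl0.le]
    exact Real.rpow_le_rpow_of_exponent_le hl (by linarith)
  -- The exponent `δ - k` may have either sign, so `δ` is dropped before `n` is compared with `ℓ`.
  have h4 : (ℓ : ℝ) ^ (-(k : ℝ)) ≤ (n : ℝ) ^ (δ - k) :=
    (Real.rpow_le_rpow_of_nonpos ha0 hal (by simp)).trans
      (Real.rpow_le_rpow_of_exponent_le ha (by linarith))
  have h5 : (ℓ : ℝ) ≤ (n : ℝ) ^ (δ - k) * b ^ δ := by
    calc (ℓ : ℝ) = (ℓ : ℝ) ^ (-(k : ℝ)) * (ℓ : ℝ) ^ ((k : ℝ) + 1) := by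
          rw [← Real.rpow_add hl0]; simp
      _ ≤ _ := by gcongr
  have hp0 : 0 < p := lt_of_le_of_lt (by positivity) hp
  calc (n : ℝ) * b * ℓ ≤ n * b * ((n : ℝ) ^ (δ - k) * b ^ δ) := by gcongr
    _ = n * b * ((n : ℝ) ^ (δ - k) * b ^ (δ - k)) * (1 * b ^ k) := by rw [← h2]; ring
    _ ≤ p * (m * b ^ k) := by rw [← h1]; gcongr

/-- The exponent is at most `n * (1 - ℓ * (ε ^ 2 / 4))`. The bracket is nonpositive, so `n` may be
replaced by `1`, which makes the error depend on the input length alone. -/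
theorem two_pow_mul_exp_le {n ℓ : ℕ} {y ε : ℝ} (hn : 1 ≤ n) (hℓ : 1 ≤ ℓ * (ε ^ 2 / 4))
    (hy : (n : ℝ) * ℓ ≤ y) :
    (2 : ℝ) ^ n * Real.exp (-(y * (ε ^ 2 / 4))) ≤ Real.exp (1 - ℓ * (ε ^ 2 / 4)) := by
  have h2 : (2 : ℝ) ^ n ≤ Real.exp n := by
    rw [← mul_one (n : ℝ), Real.exp_nat_mul]
    have := Real.add_one_le_exp 1
    gcongr
    linarith
  have hn' : (1 : ℝ) ≤ n := by exact_mod_cast hn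
  calc (2 : ℝ) ^ n * Real.exp (-(y * (ε ^ 2 / 4)))
      ≤ Real.exp n * Real.exp (-(y * (ε ^ 2 / 4))) := by gcongr
    _ = Real.exp (n - y * (ε ^ 2 / 4)) := by rw [← Real.exp_add, sub_eq_add_neg]
    _ ≤ Real.exp (1 - ℓ * (ε ^ 2 / 4)) := by
      refine Real.exp_le_exp.2 ?_
      have := mul_le_mul_of_nonneg_right hy (by positivity : 0 ≤ ε ^ 2 / 4)
      nlinarith

theorem numVars_lt_length_encCSP (Φ : CSP k) : Φ.numVars < (encCSP Φ).length := by
  rw [encCSP, List.length_append, length_encUnary]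
  omega

/-- The blow-up of an instance by a power of the length of its encoding. -/
def blowUp (c : ℕ) (Φ : CSP k) : CSP k := (blow (encCSP Φ).length)^[c] Φ

/-- The value `2` makes the claim trivial for short inputs, and the summand `1 / (ℓ + 1)` turns the
weak probability bound into the strict one required. -/
theorem tendsto_exp_error {ε : ℝ} (hε : 0 < ε) (L₀ : ℕ) :
    Tendsto (fun ℓ : ℕ => if ℓ < L₀ then (2 : ℝ) else
      Real.exp (1 - ℓ * (ε ^ 2 / 4)) + 1 / ((ℓ : ℝ) + 1)) atTop (𝓝 0) := by
  have h1 : Tendsto (fun ℓ : ℕ => Real.exp (1 - ℓ * (ε ^ 2 / 4)) + 1 / ((ℓ : ℝ) + 1)) atTop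
      (𝓝 (0 + 0)) := by
    refine Tendsto.add (Real.tendsto_exp_atBot.comp ?_) tendsto_one_div_add_atTop_nhds_zero_nat
    have : Tendsto (fun ℓ : ℕ => (ℓ : ℝ) * (ε ^ 2 / 4)) atTop atTop :=
      tendsto_natCast_atTop_atTop.atTop_mul_const (by positivity)
    exact (tendsto_atBot_add_const_left _ 1 (tendsto_neg_atTop_atBot.comp this)).congr fun ℓ => by
      simp [sub_eq_add_neg]
  rw [add_zero] at h1
  refine h1.congr' ?_
  filter_upwards [eventually_ge_atTop L₀] with ℓ hℓ
  rw [if_neg (not_lt.2 hℓ)]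

/-- For `k = 0` the threshold is `n ^ (1 + δ) ≥ 1`, which no probability exceeds. Positive arity
later guarantees that an instance with a clause has a variable. -/
theorem one_le_arity_of_threshold {k : ℕ} {δ : ℝ} (hδ : 0 < δ) {p : ℕ → unitInterval}
    (hp : ∀ᶠ n : ℕ in atTop, 1 / (n : ℝ) ^ ((k : ℝ) - 1 - δ) < p n) : 1 ≤ k := by
  by_contra hk
  obtain rfl : k = 0 := by omega
  obtain ⟨n, hn, hn1⟩ := (hp.and (eventually_ge_atTop 1)).exists
  have h1 : (1 : ℝ) ≤ n := by exact_mod_cast hn1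
  have h2 : (n : ℝ) ^ (((0 : ℕ) : ℝ) - 1 - δ) ≤ 1 :=
    Real.rpow_le_one_of_one_le_of_nonpos h1 (by simp; linarith)
  have h3 : 1 ≤ 1 / (n : ℝ) ^ (((0 : ℕ) : ℝ) - 1 - δ) := by
    rwa [one_le_div (Real.rpow_pos_of_pos (by linarith) _)]
  linarith [(p n).2.2]

/-- The set `S` treats general and simple instances together: the argument needs only closure under
blow-ups and under deletion of clauses. -/
theorem nphardUnderRobust_of_nphard (F : Set (BoolPred k)) (c s ε δ : ℝ) (hs : 0 < s)
    (hsc : s < c) (hc : c ≤ 1) (hε : 0 < ε) (hδ : 0 < δ) (hgap : s + ε < c - ε) (S : Set (CSP k))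
    (hblow : ∀ (N : ℕ) (Φ : CSP k), Φ ∈ S → blow N Φ ∈ S)
    (hsub : ∀ (Φ : CSP k) (L : List (Clause k Φ.numVars)), Φ ∈ S → L.Sublist Φ.clauses →
      ⟨Φ.numVars, L⟩ ∈ S)
    (hhard : NPHard (cspEncoding k) ((gapCSP F c s hsc).restrict S)) :
    NPHardUnderRobust (cspEncoding k) ((gapCSP F (c - ε) (s + ε) hgap).restrict S)
      {Perc | ∃ p : ℕ → unitInterval,
        (∀ᶠ n : ℕ in atTop, 1 / (n : ℝ) ^ ((k : ℝ) - 1 - δ) < p n) ∧ Perc = clausePerc p} := by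
  -- The exponent is fixed before any `p` is introduced, so the reduction does not depend on `p`.
  obtain ⟨d, hd⟩ := exists_nat_ge (((k : ℝ) + 1) / δ)
  rw [div_le_iff₀' hδ] at hd
  have hd1 : 1 ≤ d := by
    by_contra h
    obtain rfl : d = 0 := by omega
    have : (0 : ℝ) ≤ k := by positivity
    simp at hd
    linarith
  have hpos : ∀ Φ : CSP k, 0 < (encCSP Φ).length := fun Φ =>
    (Nat.zero_le _).trans_lt (numVars_lt_length_encCSP Φ)
  have hS : ∀ Φ ∈ S, blowUp d Φ ∈ S := fun Φ hΦ =>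
    Set.MapsTo.iterate (fun Ψ hΨ => hblow (encCSP Φ).length Ψ hΨ) d hΦ
  have hred : IsReduction (cspEncoding k) (cspEncoding k) ((gapCSP F c s hsc).restrict S)
      ((gapCSP F (c - ε) (s + ε) hgap).restrict S) (blowUp d) := by
    refine ⟨polyTime_blow k d, ?_, ?_⟩
    · rintro Φ ⟨⟨hF, hv⟩, hΦ⟩
      obtain ⟨-, -, h3, h4⟩ := iterate_blow _ (hpos Φ) Φ d
      refine ⟨⟨h4 F hF, ?_⟩, hS Φ hΦ⟩
      rw [blowUp, h3]
      linarith
    · rintro Φ ⟨⟨hF, hv⟩, hΦ⟩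
      obtain ⟨-, -, h3, h4⟩ := iterate_blow _ (hpos Φ) Φ d
      refine ⟨⟨h4 F hF, ?_⟩, hS Φ hΦ⟩
      rw [blowUp, h3]
      linarith
  refine ⟨CSP k, Symbol k, inferInstance, cspEncoding k, _, blowUp d, hhard, hred, ?_⟩
  rintro _ ⟨p, hp, rfl⟩
  have hk := one_le_arity_of_threshold hδ hp
  -- Beyond `n₀` the threshold condition holds, and `n₁` makes `ℓ * (ε ^ 2 / 4) ≥ 1`. Both depend on
  -- `p` or `ε` only and affect only the error function.
  obtain ⟨n₀, hn₀⟩ := eventually_atTop.1 hp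
  obtain ⟨n₁, hn₁⟩ := exists_nat_ge (1 / (ε ^ 2 / 4))
  rw [div_le_iff₀ (by positivity)] at hn₁
  have herr : ∀ (Φ : CSP k) (T : Set (CSP k)),
      (Φ.clauses = [] → ((clausePerc p (blowUp d Φ)).toOuterMeasure T).toReal = 1) →
      (Φ.clauses ≠ [] → (blowUp d Φ).clauses ≠ [] →
        1 - (2 : ℝ) ^ (blowUp d Φ).numVars * Real.exp (-(p (blowUp d Φ).numVars *
          (blowUp d Φ).clauses.length * (ε ^ 2 / 4))) ≤
        ((clausePerc p (blowUp d Φ)).toOuterMeasure T).toReal) →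
      1 - (if (encCSP Φ).length < max n₀ n₁ then (2 : ℝ) else
        Real.exp (1 - (encCSP Φ).length * (ε ^ 2 / 4)) + 1 / (((encCSP Φ).length : ℝ) + 1)) <
      ((clausePerc p (blowUp d Φ)).toOuterMeasure T).toReal := by
    intro Φ T hnil hcons
    split_ifs with hlt
    · have : 0 ≤ ((clausePerc p (blowUp d Φ)).toOuterMeasure T).toReal := ENNReal.toReal_nonneg
      linarith
    have h1 : (0 : ℝ) < 1 / (((encCSP Φ).length : ℝ) + 1) := by positivity
    have h2 := Real.exp_pos (1 - (encCSP Φ).length * (ε ^ 2 / 4))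
    by_cases hΦ : Φ.clauses = []
    · rw [hnil hΦ]
      linarith
    obtain ⟨hvars, hlen, -⟩ := iterate_blow _ (hpos Φ) Φ d
    have hm : 1 ≤ Φ.clauses.length := List.length_pos_iff.2 hΦ
    have hne : (blowUp d Φ).clauses ≠ [] := by
      rw [← List.length_pos_iff, blowUp, hlen]
      have := hpos Φ
      positivity
    obtain ⟨C, -⟩ := List.exists_mem_of_ne_nil _ hΦ
    have hn : 1 ≤ Φ.numVars := Fin.pos (C.vars ⟨0, hk⟩)
    have hnl := (numVars_lt_length_encCSP Φ).le
    set ℓ := (encCSP Φ).length with hℓ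
    have hle : max n₀ n₁ ≤ ℓ := not_lt.1 hlt
    have hvars' : (blowUp d Φ).numVars = Φ.numVars * ℓ ^ d := hvars
    have hlen' : (blowUp d Φ).clauses.length = Φ.clauses.length * (ℓ ^ d) ^ k := hlen
    -- A long encoding need not have many variables, but its blow-up does, since `d ≥ 1`; this
    -- brings the eventual condition on `p` into force.
    have hge : ℓ ≤ (blowUp d Φ).numVars := by
      rw [hvars']
      calc ℓ = 1 * ℓ ^ 1 := by ring
        _ ≤ Φ.numVars * ℓ ^ d :=
          Nat.mul_le_mul hn (Nat.pow_le_pow_right (hpos Φ) hd1)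
    have hthr := hn₀ _ (((le_max_left _ _).trans hle).trans hge)
    have hy : ((blowUp d Φ).numVars : ℝ) * ℓ ≤
        p (blowUp d Φ).numVars * (blowUp d Φ).clauses.length := by
      rw [hlen']
      generalize hq : (p (blowUp d Φ).numVars : ℝ) = q at hthr ⊢
      rw [hvars'] at hthr ⊢
      exact mul_le_of_threshold_lt hn hnl hδ hd hm hthr
    have h3 := two_pow_mul_exp_le (ε := ε) (((hpos Φ).trans_le hge : 0 < (blowUp d Φ).numVars))
      (hn₁.trans (by
        have : (n₁ : ℝ) ≤ ℓ := by exact_mod_cast (le_max_right _ _).trans hle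
        gcongr)) hy
    have h4 := hcons hΦ hne
    linarith
  refine ⟨hred, _, tendsto_exp_error hε (max n₀ n₁), ?_, ?_⟩
  · rintro Φ hΦ
    obtain ⟨⟨hF, hv⟩, hΦS⟩ := hΦ
    obtain ⟨-, hlen, h3, h4⟩ := iterate_blow _ (hpos Φ) Φ d
    refine herr Φ _ (fun hnil => toReal_clausePerc_of_eq_nil p ?_
      (hred.map_yes Φ ⟨⟨hF, hv⟩, hΦS⟩)) fun _ hne =>
      le_toReal_clausePerc_of_le_val p (blowUp d Φ) _ hε.le (by linarith) hc ?_
        (fun L' hL' hv' => ⟨⟨isOver_sublist (h4 F hF) hL', hv'⟩, hsub _ L' (hS Φ hΦS) hL'⟩) hne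
    · rw [← List.length_eq_zero_iff, blowUp, hlen, hnil]
      simp
    · rw [blowUp, h3]
      exact hv
  · rintro Φ hΦ
    obtain ⟨⟨hF, hv⟩, hΦS⟩ := hΦ
    obtain ⟨-, hlen, h3, h4⟩ := iterate_blow _ (hpos Φ) Φ d
    refine herr Φ _ (fun hnil => ?_) fun _ hne =>
      le_toReal_clausePerc_of_val_le p (blowUp d Φ) _ hε.le hs.le (by linarith) ?_
        (fun L' hL' hv' => ⟨⟨isOver_sublist (h4 F hF) hL', hv'⟩, hsub _ L' (hS Φ hΦS) hL'⟩) hne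
    -- An instance without clauses has value `1 > s`, so it is never a NO-instance.
    · exact absurd hv (by rw [CSP.val_of_eq_nil hnil]; linarith)
    · rw [blowUp, h3]
      exact hv

theorem PromiseProblem.restrict_univ {α : Type} (A : PromiseProblem α) :
    A.restrict Set.univ = A := by
  cases A
  simp [PromiseProblem.restrict]

end PercCSP

theorem mainTheorem9 (k : ℕ) (F : Set (PercCSP.BoolPred k)) (c s ε δ : ℝ)
    (hs : 0 < s) (hsc : s < c) (hc : c ≤ 1) (hε : 0 < ε) (hδ : 0 < δ)
    (hgap : s + ε < c - ε) :
    (PercCSP.NPHard (PercCSP.cspEncoding k) (PercCSP.gapCSP F c s hsc) →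
      PercCSP.NPHardUnderRobust (PercCSP.cspEncoding k)
        (PercCSP.gapCSP F (c - ε) (s + ε) hgap)
        {Perc | ∃ p : ℕ → unitInterval,
          (∀ᶠ n : ℕ in atTop, 1 / (n : ℝ) ^ ((k : ℝ) - 1 - δ) < p n) ∧
          Perc = PercCSP.clausePerc p}) ∧
    (PercCSP.NPHard (PercCSP.cspEncoding k)
        ((PercCSP.gapCSP F c s hsc).restrict {Φ | Φ.IsSimple}) →
      PercCSP.NPHardUnderRobust (PercCSP.cspEncoding k)
        ((PercCSP.gapCSP F (c - ε) (s + ε) hgap).restrict {Φ | Φ.IsSimple})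
        {Perc | ∃ p : ℕ → unitInterval,
          (∀ᶠ n : ℕ in atTop, 1 / (n : ℝ) ^ ((k : ℝ) - 1 - δ) < p n) ∧
          Perc = PercCSP.clausePerc p}) := by
  refine ⟨fun h => ?_, fun h => ?_⟩
  · have := PercCSP.nphardUnderRobust_of_nphard F c s ε δ hs hsc hc hε hδ hgap Set.univ
      (fun _ _ _ => trivial) (fun _ _ _ _ => trivial)
      (by rwa [PercCSP.PromiseProblem.restrict_univ])
    rwa [PercCSP.PromiseProblem.restrict_univ] at this
  · exact PercCSP.nphardUnderRobust_of_nphard F c s ε δ hs hsc hc hε hδ hgap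
      {Φ | Φ.IsSimple} (fun _ _ hΦ => PercCSP.isSimple_blow hΦ)
      (fun _ _ hΦ hL => PercCSP.isSimple_sublist hΦ hL) h
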